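/- **Setting.** Let $\mathcal X,\mathcal Y,\mathcal Z$ be measurable spaces and $\mathcal A$ a finite action set with $K=|\mathcal A|$. Let $\mathcal F$ and $\mathcal G$ be finite classes of conditional density models $(x,a)\mapsto f_{x,a}$ on $\mathcal Y$ and $(x,a)\mapsto g_{x,a}$ on $\mathcal Z$, containing the true models $f^*$ and $g^*$. Let $\mathcal T_1,\mathcal T_2$ be functionals of such densities with values in $[0,1]$. For $\pi\in\Delta(\mathcal A)$ write $\tilde{\mathcal T}(f_{x,\pi})=\sum_a\pi(a)\,\mathcal T(f_{x,a})$. Let $D$ be a symmetric divergence with $0\le D\le C$, $D(P\|P)=0$ and $D(P\|P'')\le C_D\,(D(P\|P')+D(P'\|P''))$ on the densities of the classes, and suppose $|\mathcal T_k(p)-\mathcal T_k(q)|\le L\,D(p\|q)$ for $k=1,2$. There is a safe action $a_0$ with $\mathcal T_1(f^*_{x,a_0})=r_0$ and $\mathcal T_2(g^*_{x,a_0})=c_0<\tau$ for every $x$. In round $t=1,2,\dots$ a context $x_t\sim Q$ is drawn independently of the past, an action $a_t\sim\pi_t(\cdot|x_t)$ is played, and $y_t\sim f^*_{x_t,a_t}$,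 $z_t\sim g^*_{x_t,a_t}$ are observed. **Oracles.** From the data of rounds $1,\dots,t-1$ the oracles produce $\hat f^t\in\mathcal F$ and $\hat g^t\in\mathcal G$. For every $t$, every $\delta'\in(0,1)$ and every (possibly adaptively chosen) data sequence sampled from the true models, with probability at least $1-\delta'$ one has $\sum_{i<t}D^2(\hat f^t_{x_i,a_i}\|f^*_{x_i,a_i})\le \mathrm{Est}(\mathcal F,t,\delta')$, and likewise for $\hat g^t,g^*,\mathcal G$. The maps $t\mapsto\mathrm{Est}(\mathcal F,t,\delta/(2t^3))$ and $t\mapsto\mathrm{Est}(\mathcal G,t,\delta/(2t^3))$ are nondecreasing on $\{1,\dots,T\}$. **Eluder dimension.** A pair $(x,a)$ is $\varepsilon$-dependent on $(x_1,a_1),\dots,(x_n,a_n)$ if for all $g,g'\in\mathcal G$, $\sum_{i\le n}D^2(g_{x_i,a_i}\|g'_{x_i,a_i})\le\varepsilon^2$ implies $D^2(g_{x,a}\|g'_{x,a})\le\varepsilon^2$, and $\varepsilon$-independent otherwise. $\dim_E(\mathcal G,D,\varepsilon)$ is the length of the longest sequence of pairs such that, for some $\varepsilon'\ge\varepsilon$,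 each pair is $\varepsilon'$-independent of its predecessors. **Algorithm GED-UCB.** Put $$\alpha_r=\frac{1-r_0}{\tau-c_0},\qquad \beta_t=\sqrt{\frac{\bigl(34\log(2|\mathcal F|t^3/\delta)+2L^2\,\mathrm{Est}(\mathcal F,t,\delta/(2t^3))\bigr)\,t}{K}},$$ $$\tilde C(t)=\Bigl\{g\in\mathcal G:\ \sum_{i<t}D^2(\hat g^t_{x_i,a_i}\|g_{x_i,a_i})\le \mathrm{Est}(\mathcal G,t,\delta/(2t^3)),\ \mathcal T_2(g_{x,a_0})=c_0\ \forall x\Bigr\},$$ $$\tilde\Pi^t(x)=\bigl\{\pi\in\Delta(\mathcal A):\tilde{\mathcal T}_2(g_{x,\pi})\le\tau\ \ \forall g\in\tilde C(t)\bigr\}\cup\{a_0\}.$$ In the first $K$ rounds (warm-up) each action is played exactly once, regardless of the context. For $t>K$, $\pi_t(\cdot|x)$ is a maximizer over $\pi\in\tilde\Pi^t(x)$, chosen by a fixed measurable tie-breaking rule, of $$\tilde{\mathcal T}_1(\hat f^t_{x,\pi})+\beta_t\,\mathbb E\Bigl[\frac1{1+\sum_{j=K+1}^{t-1}\mathbf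 1\{a=\tilde a_j\}}\Bigr]+\alpha_r\max_{g',g''\in\tilde C(t)}\bigl(\tilde{\mathcal T}_2(g'_{x,\pi})-\tilde{\mathcal T}_2(g''_{x,\pi})\bigr),$$ where $a\sim\pi$ and the counterfactual actions $\tilde a_j\sim\pi_j(\cdot|x)$ are independent. **Theorem.** For all $L$ and $C_D$ there is a constant $c>0$, depending only on $L$ and $C_D$, such that for every problem as above, every $\delta\in(0,1)$ and every $T\ge1$, with probability at least $1-\delta$ both of the following hold. 1. $\tilde{\mathcal T}_2(g^*_{x,\pi_t(\cdot|x)})\le\tau$ for every round $K<t\le T$ and every context $x$; in particular at $x=x_t$. 2. With $d=\dim_E(\mathcal G,D,1/T^2)$, which is finite, for every policy $\pi^*$ satisfying the constraint $\tilde{\mathcal T}_2(g^*_{x,\pi^*(\cdot|x)})\le\tau$ at every $x$, in particular for the optimal one, $$\sum_{t=1}^T\mathbb E_{x\sim Q}\bigl[\tilde{\mathcal T}_1(f^*_{x,\pi^*(\cdot|x)})-\tilde{\mathcal T}_1(f^*_{x,\pi_t(\cdot|x)})\bigr]\le c\,\Bigl\{2\beta_T\bigl(K+\log\tfrac TK\bigr)+2K\beta_T\log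 T+\alpha_r\Bigl(\tfrac1T+C\bigl(1+\log\tfrac1\delta\bigr)\min\{T,d\}+4\sqrt{d\;\mathrm{Est}(\mathcal G,T,\delta/(2T^3))\;T}\Bigr)\Bigr\}.$$ -/

import Mathlib

open MeasureTheory ProbabilityTheory

namespace GEDUCB

/-- The value `T̃(f_{x,π}) = ∫ T(f_{x,a}) dπ(a)` of the functional `T` at the context `x`,
under the distribution `π` over actions and the conditional model `f`. -/
noncomputable def avg {X A Y : Type*} [MeasurableSpace X] [MeasurableSpace A] [MeasurableSpace Y]
    (T : Measure Y → ℝ) (f : Kernel (X × A) Y) (x : X) (π : Measure A) : ℝ :=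
  ∫ a, T (f (x, a)) ∂π

/-- The set of all probability distributions `f_{x,a}` that occur in a model class. -/
def members {X A Y : Type*} [MeasurableSpace X] [MeasurableSpace A] [MeasurableSpace Y]
    (F : Finset (Kernel (X × A) Y)) : Set (Measure Y) :=
  {ρ | ∃ f ∈ F, ∃ p : X × A, ρ = f p}

/-- `D` is a metric-like divergence with constant `CD` on the set `S` of distributions. -/
structure IsMetricLikeOn {Y : Type*} [MeasurableSpace Y] (S : Set (Measure Y))
    (D : Measure Y → Measure Y → ℝ) (CD : ℝ) : Prop where
  symm : ∀ ρ ∈ S, ∀ ρ' ∈ S, D ρ ρ' = D ρ' ρ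
  nonneg : ∀ ρ ∈ S, ∀ ρ' ∈ S, 0 ≤ D ρ ρ'
  self : ∀ ρ ∈ S, D ρ ρ = 0
  triangle : ∀ ρ ∈ S, ∀ ρ' ∈ S, ∀ ρ'' ∈ S, D ρ ρ'' ≤ CD * (D ρ ρ' + D ρ' ρ'')

/-! ### The generalized eluder dimension -/

section Eluder

variable {X A Z : Type*} [MeasurableSpace X] [MeasurableSpace A] [MeasurableSpace Z]

/-- The pair `p` is `ε`-dependent on the finite sequence `s` of context-action pairs. -/
def EpsDependent (G : Finset (Kernel (X × A) Z)) (D : Measure Z → Measure Z → ℝ) (ε : ℝ)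
    {n : ℕ} (s : Fin n → X × A) (p : X × A) : Prop :=
  ∀ g ∈ G, ∀ g' ∈ G, ∑ i, D (g (s i)) (g' (s i)) ^ 2 ≤ ε ^ 2 → D (g p) (g' p) ^ 2 ≤ ε ^ 2

/-- Every element of the sequence `s` is `ε`-independent of its predecessors. -/
def IsEluderSeq (G : Finset (Kernel (X × A) Z)) (D : Measure Z → Measure Z → ℝ) (ε : ℝ)
    {d : ℕ} (s : Fin d → X × A) : Prop :=
  ∀ i : Fin d, ¬ EpsDependent G D ε (fun j : Fin i => s ⟨j, j.2.trans i.2⟩) (s i)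

/-- `dim_E(G, D, ε)`: the length of the longest sequence of context-action pairs such that, for
some `ε' ≥ ε`, each element is `ε'`-independent of its predecessors. -/
noncomputable def eluderDim (G : Finset (Kernel (X × A) Z)) (D : Measure Z → Measure Z → ℝ)
    (ε : ℝ) : ℕ∞ :=
  ⨆ (d : ℕ) (_ : ∃ ε' : ℝ, ε ≤ ε' ∧ ∃ s : Fin d → X × A, IsEluderSeq G D ε' s), (d : ℕ∞)

/-- For a finite class the generalized eluder dimension is finite, so that reading it as a natural
number through `ENat.toNat` is harmless. -/
theorem eluderDim_ne_top (G : Finset (Kernel (X × A) Z)) (D : Measure Z → Measure Z → ℝ)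
    (ε : ℝ) : eluderDim G D ε ≠ ⊤ := by
  classical
  have key : eluderDim G D ε ≤ (((G ×ˢ G).card : ℕ) : ℕ∞) := by
    refine iSup₂_le ?_
    rintro d ⟨ε', -, s, hs⟩
    have h : ∀ i : Fin d, ∃ q : Kernel (X × A) Z × Kernel (X × A) Z, q ∈ G ×ˢ G ∧
        ∑ j : Fin i, D (q.1 (s ⟨j, j.2.trans i.2⟩)) (q.2 (s ⟨j, j.2.trans i.2⟩)) ^ 2 ≤ ε' ^ 2 ∧
        ε' ^ 2 < D (q.1 (s i)) (q.2 (s i)) ^ 2 := by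
      intro i
      have hi := hs i
      unfold EpsDependent at hi
      push Not at hi
      obtain ⟨g, hg, g', hg', h1, h2⟩ := hi
      exact ⟨(g, g'), Finset.mem_product.2 ⟨hg, hg'⟩, h1, h2⟩
    choose q hq h1 h2 using h
    have hlt : ∀ i j : Fin d, i < j → q i ≠ q j := by
      intro i j hij he
      have h3 := h1 j
      have h4 : D ((q j).1 (s i)) ((q j).2 (s i)) ^ 2 ≤ ∑ k : Fin j,
          D ((q j).1 (s ⟨k, k.2.trans j.2⟩)) ((q j).2 (s ⟨k, k.2.trans j.2⟩)) ^ 2 :=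
        Finset.single_le_sum (f := fun k : Fin j =>
          D ((q j).1 (s ⟨k, k.2.trans j.2⟩)) ((q j).2 (s ⟨k, k.2.trans j.2⟩)) ^ 2)
          (fun k _ => sq_nonneg _) (Finset.mem_univ (⟨i, hij⟩ : Fin j))
      have h5 := h2 i
      rw [he] at h5
      linarith
    have hinj : Function.Injective q := by
      intro i j he
      rcases lt_trichotomy i j with h | h | h
      · exact absurd he (hlt i j h)
      · exact h
      · exact absurd he.symm (hlt j i h)
    have hc : (Finset.univ : Finset (Fin d)).card ≤ (G ×ˢ G).card :=
      Finset.card_le_card_of_injOn q (fun i _ => hq i) (fun i _ j _ h => hinj h)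
    rw [Finset.card_univ, Fintype.card_fin] at hc
    exact_mod_cast hc
  exact ne_top_of_le_ne_top (ENat.natCast_ne_top _) key

end Eluder

/-! ### Offline density estimation oracles -/

section Oracle

variable {X A Y : Type*} [MeasurableSpace X] [MeasurableSpace A] [MeasurableSpace Y]

/-- `P` is the law of a sequence `((x_i, a_i), y_i)` in which the pairs `(x_i, a_i)` are chosen in
an arbitrary, possibly adaptive and randomized way and, given `(x_i, a_i)` and the earlier
data, `y_i` has the law `f*_{x_i,a_i}`. -/
def IsSampledFrom (fstar : Kernel (X × A) Y) (P : Measure (ℕ → (X × A) × Y)) : Prop :=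
  ∀ i : ℕ,
    P.map (fun w => (((fun j : Fin i => w j), (w i).1), (w i).2)) =
      (P.map (fun w => ((fun j : Fin i => w j), (w i).1))) ⊗ₘ
        (Kernel.prodMkLeft (Fin i → (X × A) × Y) fstar)

/-- `alg` maps `n` data points to an estimate in the class `F` (the `(n+1)`-st estimator), and on
every data sequence sampled from `fstar` its cumulative squared divergence to `fstar`
on those `n` points is at most `est (n+1) δ` with probability at least `1 - δ`. -/
structure IsOfflineOracle (F : Finset (Kernel (X × A) Y)) (D : Measure Y → Measure Y → ℝ)
    (fstar : Kernel (X × A) Y) (alg : (n : ℕ) → (Fin n → (X × A) × Y) → Kernel (X × A) Y)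
    (est : ℕ → ℝ → ℝ) : Prop where
  mem : ∀ n s, alg n s ∈ F
  measurable : ∀ n, ∀ f ∈ F, MeasurableSet {s | alg n s = f}
  guarantee : ∀ P : Measure (ℕ → (X × A) × Y), IsProbabilityMeasure P → IsSampledFrom fstar P →
    ∀ (n : ℕ) (δ : ℝ), 0 < δ → δ < 1 →
      P {w | est (n + 1) δ <
        ∑ i : Fin n, D (alg n (fun j : Fin n => w j) (w i).1) (fstar (w i).1) ^ 2}
        ≤ ENNReal.ofReal δ

end Oracle

/-! ### The decision problem -/

/-- The data of a constrained decision problem together with two estimation oracles. A conditional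
density model is recorded as the kernel `(x, a) ↦ f_{x,a}` of the laws with these densities. -/
structure Problem (X A Y Z : Type*) [MeasurableSpace X] [MeasurableSpace A] [MeasurableSpace Y]
    [MeasurableSpace Z] where
  /-- law of the contexts -/
  Q : Measure X
  /-- utility class -/
  F : Finset (Kernel (X × A) Y)
  /-- constraint class -/
  G : Finset (Kernel (X × A) Z)
  /-- true utility model -/
  fstar : Kernel (X × A) Y
  /-- true constraint model -/
  gstar : Kernel (X × A) Z
  /-- utility functional -/
  T₁ : Measure Y → ℝ
  /-- constraint functional -/
  T₂ : Measure Z → ℝ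
  /-- divergence between laws of utility observations -/
  D₁ : Measure Y → Measure Y → ℝ
  /-- divergence between laws of constraint observations -/
  D₂ : Measure Z → Measure Z → ℝ
  /-- upper bound for the divergence -/
  C : ℝ
  /-- constraint threshold -/
  τ : ℝ
  /-- safe action -/
  a₀ : A
  /-- utility of the safe action -/
  r₀ : ℝ
  /-- constraint value of the safe action -/
  c₀ : ℝ
  /-- oracle for the utility class -/
  algF : (n : ℕ) → (Fin n → (X × A) × Y) → Kernel (X × A) Y
  /-- oracle for the constraint class -/
  algG : (n : ℕ) → (Fin n → (X × A) × Z) → Kernel (X × A) Z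
  /-- the error bound `Est(F, i, δ)` -/
  estF : ℕ → ℝ → ℝ
  /-- the error bound `Est(G, i, δ)` -/
  estG : ℕ → ℝ → ℝ

/-- The standing assumptions, with Lipschitz constant `L` and metric-like constant `CD`. -/
structure Problem.Valid {X A Y Z : Type*} [MeasurableSpace X] [MeasurableSpace A]
    [MeasurableSpace Y] [MeasurableSpace Z] (P : Problem X A Y Z) (L CD : ℝ) : Prop where
  prob_Q : IsProbabilityMeasure P.Q
  markov_F : ∀ f ∈ P.F, IsMarkovKernel f
  markov_G : ∀ g ∈ P.G, IsMarkovKernel g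
  fstar_mem : P.fstar ∈ P.F
  gstar_mem : P.gstar ∈ P.G
  -- the functionals take values in `[0, 1]`
  T₁_mem : ∀ ρ ∈ members P.F, P.T₁ ρ ∈ Set.Icc (0 : ℝ) 1
  T₂_mem : ∀ ρ ∈ members P.G, P.T₂ ρ ∈ Set.Icc (0 : ℝ) 1
  -- the divergence is metric-like and bounded by `C`
  metric₁ : IsMetricLikeOn (members P.F) P.D₁ CD
  metric₂ : IsMetricLikeOn (members P.G) P.D₂ CD
  D₁_le : ∀ ρ ∈ members P.F, ∀ ρ' ∈ members P.F, P.D₁ ρ ρ' ≤ P.C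
  D₂_le : ∀ ρ ∈ members P.G, ∀ ρ' ∈ members P.G, P.D₂ ρ ρ' ≤ P.C
  -- the functionals are Lipschitz with respect to the divergence
  lip₁ : ∀ ρ ∈ members P.F, ∀ ρ' ∈ members P.F, |P.T₁ ρ - P.T₁ ρ'| ≤ L * P.D₁ ρ ρ'
  lip₂ : ∀ ρ ∈ members P.G, ∀ ρ' ∈ members P.G, |P.T₂ ρ - P.T₂ ρ'| ≤ L * P.D₂ ρ ρ'
  -- measurability
  meas_T₁ : ∀ f ∈ P.F, Measurable fun p : X × A => P.T₁ (f p)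
  meas_T₂ : ∀ g ∈ P.G, Measurable fun p : X × A => P.T₂ (g p)
  meas_D₁ : ∀ f ∈ P.F, ∀ f' ∈ P.F, Measurable fun p : X × A => P.D₁ (f p) (f' p)
  meas_D₂ : ∀ g ∈ P.G, ∀ g' ∈ P.G, Measurable fun p : X × A => P.D₂ (g p) (g' p)
  -- the safe action
  safe_utility : ∀ x, P.T₁ (P.fstar (x, P.a₀)) = P.r₀
  safe_constraint : ∀ x, P.T₂ (P.gstar (x, P.a₀)) = P.c₀
  c₀_lt : P.c₀ < P.τ
  -- the oracles
  oracleF : IsOfflineOracle P.F P.D₁ P.fstar P.algF P.estF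
  oracleG : IsOfflineOracle P.G P.D₂ P.gstar P.algG P.estG

/-! ### The algorithm

Rounds are numbered from `0` here: the round of index `n` is round `t = n + 1`, and before it the
history consists of the `n` quadruples `(x_i, a_i, y_i, z_i)`, `i < n`. The number of actions is
`K = Fintype.card A`. -/

/-- Histories of length `n`. -/
abbrev Hist (X A Y Z : Type*) (n : ℕ) := Fin n → X × A × Y × Z

section Algorithm

variable {X A Y Z : Type*} [MeasurableSpace X] [MeasurableSpace A] [MeasurableSpace Y]
  [MeasurableSpace Z]

/-- The first `i` rounds of a history. -/
def Hist.take {n : ℕ} (h : Hist X A Y Z n) (i : Fin n) : Hist X A Y Z i :=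
  fun j => h ⟨j, j.2.trans i.2⟩

/-- The estimate `f̂^t`, `t = n + 1`. -/
noncomputable def Problem.fhat (P : Problem X A Y Z) {n : ℕ} (h : Hist X A Y Z n) :
    Kernel (X × A) Y :=
  P.algF n fun i => (((h i).1, (h i).2.1), (h i).2.2.1)

/-- The estimate `ĝ^t`, `t = n + 1`. -/
noncomputable def Problem.ghat (P : Problem X A Y Z) {n : ℕ} (h : Hist X A Y Z n) :
    Kernel (X × A) Z :=
  P.algG n fun i => (((h i).1, (h i).2.1), (h i).2.2.2)

/-- `Est(F, t, δ / (2 t³))`. -/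
noncomputable def Problem.radF (P : Problem X A Y Z) (δ : ℝ) (t : ℕ) : ℝ :=
  P.estF t (δ / (2 * (t : ℝ) ^ 3))

/-- `Est(G, t, δ / (2 t³))`. -/
noncomputable def Problem.radG (P : Problem X A Y Z) (δ : ℝ) (t : ℕ) : ℝ :=
  P.estG t (δ / (2 * (t : ℝ) ^ 3))

/-- The confidence set `C̃_G(t, δ)`, `t = n + 1`. -/
def Problem.confSet (P : Problem X A Y Z) (δ : ℝ) {n : ℕ} (h : Hist X A Y Z n) :
    Set (Kernel (X × A) Z) :=
  {g | g ∈ P.G ∧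
    ∑ i, P.D₂ (P.ghat h ((h i).1, (h i).2.1)) (g ((h i).1, (h i).2.1)) ^ 2 ≤ P.radG δ (n + 1) ∧
    ∀ x, P.T₂ (g (x, P.a₀)) = P.c₀}

/-- The estimated feasible policy set `Π̃^t_δ(x)`, `t = n + 1`. -/
def Problem.feasSet (P : Problem X A Y Z) (δ : ℝ) {n : ℕ} (h : Hist X A Y Z n) (x : X) :
    Set (Measure A) :=
  {π | IsProbabilityMeasure π ∧ ∀ g ∈ P.confSet δ h, avg P.T₂ g x π ≤ P.τ} ∪
    {Measure.dirac P.a₀}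

/-- `max_{g', g'' ∈ C̃_G(t, δ)} (T̃₂(g'_{x,π}) - T̃₂(g''_{x,π}))`, `t = n + 1`. -/
noncomputable def Problem.width (P : Problem X A Y Z) (δ : ℝ) {n : ℕ} (h : Hist X A Y Z n) (x : X)
    (π : Measure A) : ℝ :=
  sSup {r | ∃ g' ∈ P.confSet δ h, ∃ g'' ∈ P.confSet δ h, r = avg P.T₂ g' x π - avg P.T₂ g'' x π}

/-- `α_r`. -/
noncomputable def Problem.alpha (P : Problem X A Y Z) : ℝ := (1 - P.r₀) / (P.τ - P.c₀)

variable [Fintype A]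

/-- `β_t`. -/
noncomputable def Problem.beta (P : Problem X A Y Z) (L δ : ℝ) (t : ℕ) : ℝ :=
  Real.sqrt ((34 * Real.log (2 * (P.F.card : ℝ) * (t : ℝ) ^ 3 / δ) + 2 * L ^ 2 * P.radF δ t) *
    (t : ℝ) / (Fintype.card A : ℝ))

open Classical in
/-- `E[1 / (∑_j 1{a = ã_j} + 1)]` for independent `a ∼ π` and `ã_j ∼ ν_j`, the sum being over the
rounds after the warm-up phase. -/
noncomputable def bonus {n : ℕ} (ν : Fin n → Measure A) (π : Measure A) : ℝ :=
  ∫ a, (∫ b : Fin n → A,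
    1 / ((∑ j : Fin n, if Fintype.card A ≤ (j : ℕ) ∧ a = b j then (1 : ℝ) else 0) + 1)
      ∂(Measure.pi ν)) ∂π

/-- The upper confidence bound of round `t = n + 1` at the context `x`, as a function of the action
distribution `π`. The counterfactual policies at `x` are the earlier policies, applied to the
earlier histories and to `x`. -/
noncomputable def Problem.ucb (P : Problem X A Y Z) (L δ : ℝ)
    (pol : (n : ℕ) → Kernel (Hist X A Y Z n × X) A) {n : ℕ} (h : Hist X A Y Z n) (x : X)
    (π : Measure A) : ℝ :=
  avg P.T₁ (P.fhat h) x π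
    + P.beta L δ (n + 1) * bonus (fun j : Fin n => pol j (h.take j, x)) π
    + P.alpha * P.width δ h x π

/-- `pol` is a run of the algorithm GED-UCB: `pol n (h, x)` is the action distribution
`π_t(· | x)` of round `t = n + 1` after the history `h`. In the first `K` rounds each action is
played exactly once; afterwards the upper confidence bound is maximized over the
estimated feasible policy set, ties being broken by any (measurable) rule. -/
structure Problem.IsGEDUCB (P : Problem X A Y Z) (L δ : ℝ)
    (pol : (n : ℕ) → Kernel (Hist X A Y Z n × X) A) : Prop where
  warmup : ∃ e : Fin (Fintype.card A) ≃ A, ∀ (n : ℕ) (hn : n < Fintype.card A)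
    (h : Hist X A Y Z n) (x : X), pol n (h, x) = Measure.dirac (e ⟨n, hn⟩)
  mem : ∀ n : ℕ, Fintype.card A ≤ n → ∀ (h : Hist X A Y Z n) (x : X),
    pol n (h, x) ∈ P.feasSet δ h x
  argmax : ∀ n : ℕ, Fintype.card A ≤ n → ∀ (h : Hist X A Y Z n) (x : X),
    ∀ π ∈ P.feasSet δ h x, P.ucb L δ pol h x π ≤ P.ucb L δ pol h x (pol n (h, x))

end Algorithm

/-! ### The interaction and the regret -/

section Interaction

variable {X A Y Z Ω : Type*} [MeasurableSpace X] [MeasurableSpace A] [MeasurableSpace Y]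
  [MeasurableSpace Z] [MeasurableSpace Ω]

/-- The history of the first `n` rounds of the process `W`. -/
def hist (W : ℕ → Ω → X × A × Y × Z) (n : ℕ) (ω : Ω) : Hist X A Y Z n := fun i => W i ω

/-- The process `W` of quadruples `(x, a, y, z)` is produced by the policies `pol`: the context is
drawn from `Q` independently of the past; given the past and the context, the action is
drawn from the policy; given the past, the context and the action, `y` has law
`f*_{x,a}` and `z` has law `g*_{x,a}`. -/
structure Problem.IsInteraction (P : Problem X A Y Z)
    (pol : (n : ℕ) → Kernel (Hist X A Y Z n × X) A) (μ : Measure Ω)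
    (W : ℕ → Ω → X × A × Y × Z) : Prop where
  measurable : ∀ n, Measurable (W n)
  context : ∀ n, μ.map (fun ω => (hist W n ω, (W n ω).1)) = (μ.map (hist W n)).prod P.Q
  action : ∀ n, μ.map (fun ω => ((hist W n ω, (W n ω).1), (W n ω).2.1)) =
    (μ.map (fun ω => (hist W n ω, (W n ω).1))) ⊗ₘ (pol n)
  utility : ∀ n,
    μ.map (fun ω => ((hist W n ω, ((W n ω).1, (W n ω).2.1)), (W n ω).2.2.1)) =
      (μ.map (fun ω => (hist W n ω, ((W n ω).1, (W n ω).2.1)))) ⊗ₘ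
        (Kernel.prodMkLeft (Hist X A Y Z n) P.fstar)
  constraint : ∀ n,
    μ.map (fun ω => ((hist W n ω, ((W n ω).1, (W n ω).2.1)), (W n ω).2.2.2)) =
      (μ.map (fun ω => (hist W n ω, ((W n ω).1, (W n ω).2.1)))) ⊗ₘ
        (Kernel.prodMkLeft (Hist X A Y Z n) P.gstar)

/-- The stationary policy `πs` satisfies the true constraint at every context. -/
def Problem.IsFeasiblePolicy (P : Problem X A Y Z) (πs : Kernel X A) : Prop :=
  ∀ x, avg P.T₂ P.gstar x (πs x) ≤ P.τ

/-- The utility regret over the rounds `1, …, T` against the policy `πs`. -/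
noncomputable def Problem.regret (P : Problem X A Y Z)
    (pol : (n : ℕ) → Kernel (Hist X A Y Z n × X) A) (W : ℕ → Ω → X × A × Y × Z) (T : ℕ)
    (πs : Kernel X A) (ω : Ω) : ℝ :=
  (∑ _n ∈ Finset.range T, ∫ x, avg P.T₁ P.fstar x (πs x) ∂P.Q) -
    ∑ n ∈ Finset.range T, ∫ x, avg P.T₁ P.fstar x (pol n (hist W n ω, x)) ∂P.Q

variable [Fintype A]

/-- The rate in the regret bound; `d` is the generalized eluder dimension of the constraint class at
scale `1 / T²`. -/
noncomputable def Problem.rate (P : Problem X A Y Z) (L δ : ℝ) (T : ℕ) : ℝ :=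
  let K : ℝ := Fintype.card A
  let d : ℝ := (eluderDim P.G P.D₂ (1 / (T : ℝ) ^ 2)).toNat
  2 * P.beta L δ T * (K + Real.log (T / K)) + 2 * K * P.beta L δ T * Real.log T
    + P.alpha * (1 / (T : ℝ) + P.C * (1 + Real.log (1 / δ)) * min (T : ℝ) d
      + 4 * Real.sqrt (d * P.radG δ T * T))

end Interaction

end GEDUCB

namespace GEDUCB

/-! ### Eluder dimension: counting and summing large discrepancies -/

section Eluder

variable {X A Z : Type*} [MeasurableSpace X] [MeasurableSpace A] [MeasurableSpace Z]

/-! The argument runs on one event of probability at least `1 - δ` on which, for every round `K < t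
≤ T`, `g*` lies in the confidence set; the squared utility errors of `f̂ᵗ`, averaged over the
policies of the earlier rounds, sum to at most `2 (L² Est + log (2|F|t³/δ))`; and the conditional
means of the confidence-set diameters sum to at most twice the observed diameters plus `2 C log
(2/δ)`. The two concentration statements come from an exponential supermartingale
(`lintegral_exp_sum_le_one`), with a union bound over `F` because `f̂ᵗ` depends on the data.
Feasibility is immediate there: a policy that is safe for all models of the confidence set is safe
for `g*`.

For the regret, fix a context `x` and let `N_a` be the total probability with which earlier policies
play `a` at `x`; the warm-up makes `N_a ≥ 1`. If `Δ_a` is the utility error, AM-GM gives `|Δ_a| ≤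
β/N_a + N_a Δ_a²/(4β)`. By Jensen the first term averages to at most `β` times the bonus. The second
is a residual independent of the policy being evaluated; since contexts are fresh draws from `Q`,
its integral over `x` is a sum of conditional means, hence at most `β K/(4t)` by the choice of
`β_t`.

Optimism must cope with a feasible `π` that is not in the estimated feasible set. If `w` is the
width at `π`, mixing `π` with the safe action at weight `γ = (τ - c₀)/(τ - c₀ + w)` makes it
feasible for all models of the confidence set. The utility lost is at most `(1 - γ)(1 - r₀) = α_r γ
w`, which the width term of the upper confidence bound repays. So the regret of a round at `x` is at
most `2 β · bonus + α_r · width + 2 · residual`.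

Summation over rounds: the bonuses telescope in a harmonic potential, at most `K (1 + log T)`; the
residuals give another harmonic sum; the widths are at most `|L|` times mean diameters, which
concentrate around the observed ones, and those are summed through the eluder dimension. Horizons `T
≤ K` are treated apart, by the trivial bound `T` on the regret. -/

theorem IsEluderSeq.length_le_toNat_eluderDim {G : Finset (Kernel (X × A) Z)}
    {D : Measure Z → Measure Z → ℝ} {ε ε' : ℝ} (hε : ε ≤ ε') {d : ℕ} {s : Fin d → X × A}
    (hs : IsEluderSeq G D ε' s) : d ≤ (eluderDim G D ε).toNat := by
  have h : (d : ℕ∞) ≤ eluderDim G D ε :=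
    le_iSup₂_of_le (f := fun (d : ℕ) (_ : ∃ ε' : ℝ, ε ≤ ε' ∧ ∃ s : Fin d → X × A,
      IsEluderSeq G D ε' s) => (d : ℕ∞)) d ⟨ε', hε, s, hs⟩ le_rfl
  simpa using ENat.toNat_le_toNat h (eluderDim_ne_top G D ε)

/-- If every point of `S` is witnessed as `ε`-large by a pair of models that are `ρ`-close on the
past, then `S` can be coloured with `m > ρ / ε²` colours so that each point is
`ε`-independent of its predecessors of the same colour. -/
theorem exists_independent_coloring {G : Finset (Kernel (X × A) Z)}
    {D : Measure Z → Measure Z → ℝ} {ε ρ : ℝ} {m : ℕ} (hm : 0 < m) (hρ : ρ < m * ε ^ 2)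
    (p : ℕ → X × A) (S : Finset ℕ)
    (hS : ∀ t ∈ S, ∃ g ∈ G, ∃ g' ∈ G, ∑ i ∈ Finset.range t, D (g (p i)) (g' (p i)) ^ 2 ≤ ρ ∧
      ε ^ 2 < D (g (p t)) (g' (p t)) ^ 2) :
    ∃ c : ℕ → Fin m, ∀ t ∈ S, ∃ g ∈ G, ∃ g' ∈ G,
      ∑ i ∈ S with i < t ∧ c i = c t, D (g (p i)) (g' (p i)) ^ 2 ≤ ε ^ 2 ∧
      ε ^ 2 < D (g (p t)) (g' (p t)) ^ 2 := by
  suffices H : ∀ n : ℕ, ∃ c : ℕ → Fin m, ∀ t ∈ S, t < n → ∃ g ∈ G, ∃ g' ∈ G,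
      ∑ i ∈ S with i < t ∧ c i = c t, D (g (p i)) (g' (p i)) ^ 2 ≤ ε ^ 2 ∧
      ε ^ 2 < D (g (p t)) (g' (p t)) ^ 2 by
    obtain ⟨c, hc⟩ := H (S.sup id + 1)
    exact ⟨c, fun t ht => hc t ht (Nat.lt_succ_of_le (Finset.le_sup (f := id) ht))⟩
  intro n
  induction n with
  | zero => exact ⟨fun _ => ⟨0, hm⟩, fun t _ ht => absurd ht (Nat.not_lt_zero t)⟩
  | succ n ih =>
    obtain ⟨c, hc⟩ := ih
    by_cases hn : n ∈ S
    · obtain ⟨g, hg, g', hg', h1, h2⟩ := hS n hn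
      -- Pigeonhole: the colours split a past of total at most `ρ < m ε²`, so some colour carries at
      -- most `ε²` of it.
      have hk : ∃ k : Fin m,
          ∑ i ∈ S with i < n ∧ c i = k, D (g (p i)) (g' (p i)) ^ 2 ≤ ε ^ 2 := by
        by_contra! hcon
        have h3 : ∑ k : Fin m, ∑ i ∈ S with i < n ∧ c i = k, D (g (p i)) (g' (p i)) ^ 2
            = ∑ i ∈ S with i < n, D (g (p i)) (g' (p i)) ^ 2 := by
          simp_rw [← Finset.filter_filter]
          exact Finset.sum_fiberwise _ _ _
        have h4 : ∑ i ∈ S with i < n, D (g (p i)) (g' (p i)) ^ 2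
            ≤ ∑ i ∈ Finset.range n, D (g (p i)) (g' (p i)) ^ 2 :=
          Finset.sum_le_sum_of_subset_of_nonneg
            (fun i hi => Finset.mem_range.2 (Finset.mem_filter.1 hi).2) fun _ _ _ => sq_nonneg _
        have h5 : ∑ _k : Fin m, ε ^ 2
            ≤ ∑ k : Fin m, ∑ i ∈ S with i < n ∧ c i = k, D (g (p i)) (g' (p i)) ^ 2 :=
          Finset.sum_le_sum fun k _ => (hcon k).le
        simp only [Finset.sum_const, Finset.card_univ, Fintype.card_fin, nsmul_eq_mul] at h5
        linarith
      obtain ⟨k, hk⟩ := hk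
      refine ⟨Function.update c n k, fun t ht htn => ?_⟩
      rcases Nat.lt_succ_iff_lt_or_eq.1 htn with h | rfl
      · obtain ⟨g, hg, g', hg', h1, h2⟩ := hc t ht h
        refine ⟨g, hg, g', hg', ?_, h2⟩
        convert h1 using 3
        rename_i i
        refine and_congr_right fun hi => ?_
        rw [Function.update_of_ne (hi.trans h).ne, Function.update_of_ne h.ne]
      · refine ⟨g, hg, g', hg', ?_, h2⟩
        convert hk using 3
        rename_i i
        refine and_congr_right fun hi => ?_
        rw [Function.update_of_ne hi.ne, Function.update_self]
    · refine ⟨c, fun t ht htn => hc t ht ?_⟩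
      rcases Nat.lt_succ_iff_lt_or_eq.1 htn with h | rfl
      · exact h
      · exact absurd ht hn

/-- The number of rounds in which two models that are `ρ`-close on the past differ by more than
`ε` is controlled by the eluder dimension. -/
theorem card_le_eluderDim {G : Finset (Kernel (X × A) Z)}
    {D : Measure Z → Measure Z → ℝ} {ε₀ ε ρ : ℝ} (hε₀ : ε₀ ≤ ε) (hε : 0 < ε) (hρ : 0 ≤ ρ)
    (p : ℕ → X × A) (S : Finset ℕ)
    (hS : ∀ t ∈ S, ∃ g ∈ G, ∃ g' ∈ G, ∑ i ∈ Finset.range t, D (g (p i)) (g' (p i)) ^ 2 ≤ ρ ∧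
      ε < D (g (p t)) (g' (p t))) :
    (S.card : ℝ) ≤ (ρ / ε ^ 2 + 1) * (eluderDim G D ε₀).toNat := by
  -- The least `m` with `ρ < m ε²`. Each colour class, listed increasingly, is an `ε`-eluder
  -- sequence, so its size is at most the dimension.
  set m := ⌊ρ / ε ^ 2⌋₊ + 1 with hm
  have hρm : ρ < m * ε ^ 2 := by
    have := Nat.lt_floor_add_one (ρ / ε ^ 2)
    rw [div_lt_iff₀ (by positivity)] at this
    simpa [hm] using this
  obtain ⟨c, hc⟩ := exists_independent_coloring (G := G) (D := D) (Nat.succ_pos _) hρm p S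
    (fun t ht => by
      obtain ⟨g, hg, g', hg', h1, h2⟩ := hS t ht
      exact ⟨g, hg, g', hg', h1, pow_lt_pow_left₀ h2 hε.le two_ne_zero⟩)
  have hfib : ∀ k : Fin m, (S.filter fun i => c i = k).card ≤ (eluderDim G D ε₀).toNat := by
    intro k
    set Sk := S.filter fun i => c i = k with hSk
    let e := Sk.orderEmbOfFin rfl
    have he : ∀ i, e i ∈ S ∧ c (e i) = k := fun i =>
      Finset.mem_filter.1 (Finset.orderEmbOfFin_mem Sk rfl i)
    refine IsEluderSeq.length_le_toNat_eluderDim hε₀ (s := fun i => p (e i)) ?_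
    intro i hdep
    obtain ⟨g, hg, g', hg', h1, h2⟩ := hc (e i) (he i).1
    refine absurd (hdep g hg g' hg' (le_trans ?_ h1)) (not_le.2 h2)
    let F : ℕ → ℝ := fun j => D (g (p j)) (g' (p j)) ^ 2
    let q : Fin i ↪ ℕ := ⟨fun j => e ⟨j, j.2.trans i.2⟩, fun a b hab => by
      have := e.injective hab
      simpa [Fin.ext_iff] using this⟩
    have hmap : ∑ j : Fin i, F (q j) = ∑ j ∈ Finset.univ.map q, F j :=
      (Finset.sum_map _ _ _).symm
    refine le_of_eq_of_le hmap ?_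
    refine Finset.sum_le_sum_of_subset_of_nonneg ?_ fun _ _ _ => sq_nonneg _
    intro j hj
    obtain ⟨l, -, rfl⟩ := Finset.mem_map.1 hj
    refine Finset.mem_filter.2 ⟨(he _).1, ?_, (he _).2.trans (he _).2.symm⟩
    exact e.strictMono (show (⟨l, l.2.trans i.2⟩ : Fin _) < i from l.2)
  have hcard : S.card ≤ m * (eluderDim G D ε₀).toNat := by
    have h1 : S.card = ∑ k : Fin m, (S.filter fun i => c i = k).card :=
      Finset.card_eq_sum_card_fiberwise fun _ _ => Finset.mem_univ _
    rw [h1]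
    refine (Finset.sum_le_sum fun k _ => hfib k).trans ?_
    simp
  have hmle : (m : ℝ) ≤ ρ / ε ^ 2 + 1 := by
    have := Nat.floor_le (show 0 ≤ ρ / ε ^ 2 by positivity)
    rw [hm]; push_cast; linarith
  calc (S.card : ℝ) ≤ m * (eluderDim G D ε₀).toNat := by exact_mod_cast hcard
    _ ≤ _ := by gcongr

/-- If the number of values exceeding `ε` is at most `(ρ / ε² + 1) d`, for all `ε > ε₀`, then the
sum of the values is of order `C d + √(d ρ n)`. -/
theorem sum_le_of_card_filter_le {ι : Type*} (f : ι → ℝ) {C ε₀ ρ : ℝ} {d : ℕ} (hε₀ : 0 ≤ ε₀)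
    (hρ : 0 ≤ ρ) (S : Finset ι) (hfC : ∀ s ∈ S, f s ≤ C)
    (hcard : ∀ ε, ε₀ < ε → ((S.filter fun s => ε < f s).card : ℝ) ≤ (ρ / ε ^ 2 + 1) * d) :
    ∑ s ∈ S, f s ≤ S.card * ε₀ + C * (min S.card d : ℕ)
      + 2 * Real.sqrt (d * ρ) * Real.sqrt ((S.card - d : ℕ) : ℝ) := by
  classical
  -- Values enter in decreasing order: the first `d` are bounded by `C`, and the `(d + k + 1)`-st
  -- largest by `ε₀ + √(dρ/(k+1))`, since `d + k + 1` values above `ε` force `k + 1 ≤ dρ/ε²`.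
  induction S using Finset.induction_on_min_value f with
  | empty => simp
  | insert a s ha hmin ih =>
    have ih' := ih (fun x hx => hfC x (Finset.mem_insert_of_mem hx)) (fun ε hε => by
      refine le_trans ?_ (hcard ε hε)
      exact_mod_cast Finset.card_le_card
        (Finset.filter_subset_filter _ (Finset.subset_insert a s)))
    rw [Finset.sum_insert ha, Finset.card_insert_of_notMem ha]
    have hq : 0 ≤ Real.sqrt (d * ρ) := Real.sqrt_nonneg _
    by_cases hle : s.card + 1 ≤ d
    · have h1 : min (s.card + 1) d = s.card + 1 := min_eq_left hle
      have h2 : min s.card d = s.card := min_eq_left (by omega)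
      have h3 : s.card + 1 - d = 0 := by omega
      have h4 : s.card - d = 0 := by omega
      rw [h1, h3]
      rw [h2, h4] at ih'
      have := hfC a (Finset.mem_insert_self a s)
      push_cast at ih' ⊢
      nlinarith
    · obtain ⟨k, hk⟩ : ∃ k, s.card = d + k := ⟨s.card - d, by omega⟩
      have h1 : min (s.card + 1) d = d := min_eq_right (by omega)
      have h2 : min s.card d = d := min_eq_right (by omega)
      have h3 : s.card + 1 - d = k + 1 := by omega
      have h4 : s.card - d = k := by omega
      rw [h1, h3]
      rw [h2, h4] at ih'
      have hsk : 0 < Real.sqrt ((k + 1 : ℕ) : ℝ) := Real.sqrt_pos.2 (by positivity)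
      have hfa : f a ≤ ε₀ + Real.sqrt (d * ρ) / Real.sqrt ((k + 1 : ℕ) : ℝ) := by
        by_contra! hcon
        obtain ⟨ε, hε1, hε2⟩ := exists_between hcon
        have hdiv : 0 ≤ Real.sqrt (d * ρ) / Real.sqrt ((k + 1 : ℕ) : ℝ) := by positivity
        have hε0 : ε₀ < ε := by linarith
        have hεpos : 0 < ε := by linarith
        have hall : (insert a s).filter (fun x => ε < f x) = insert a s := by
          refine Finset.filter_true_of_mem fun x hx => ?_
          rcases Finset.mem_insert.1 hx with rfl | hx
          · exact hε2
          · exact hε2.trans_le (hmin x hx)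
        have hc := hcard ε hε0
        rw [hall, Finset.card_insert_of_notMem ha, hk] at hc
        have hε3 : Real.sqrt (d * ρ) / Real.sqrt ((k + 1 : ℕ) : ℝ) < ε := by linarith
        rw [div_lt_iff₀ hsk] at hε3
        have h5 : (d * ρ : ℝ) < ε ^ 2 * (k + 1) := by
          have h6 := pow_lt_pow_left₀ hε3 hq two_ne_zero
          rw [Real.sq_sqrt (by positivity), mul_pow, Real.sq_sqrt (by positivity)] at h6
          push_cast at h6
          exact h6
        have h7 : ((k : ℝ) + 1) ≤ ρ / ε ^ 2 * d := by push_cast at hc; linarith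
        rw [div_mul_eq_mul_div, le_div_iff₀ (by positivity)] at h7
        linarith
      -- The increment of `2√k` dominates `1/√(k+1)`.
      have hsq : Real.sqrt (k : ℝ) + 1 / (2 * Real.sqrt ((k + 1 : ℕ) : ℝ))
          ≤ Real.sqrt ((k + 1 : ℕ) : ℝ) := by
        set u := Real.sqrt ((k + 1 : ℕ) : ℝ) with hu
        set v := Real.sqrt (k : ℝ) with hv
        have hu2 : u ^ 2 = k + 1 := by rw [hu, Real.sq_sqrt (by positivity)]; push_cast; ring
        have hv2 : v ^ 2 = k := by rw [hv, Real.sq_sqrt (by positivity)]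
        have hv0 : 0 ≤ v := Real.sqrt_nonneg _
        rw [← le_sub_iff_add_le', div_le_iff₀ (by positivity)]
        nlinarith [sq_nonneg (u - v)]
      have hkey : Real.sqrt (d * ρ) / Real.sqrt ((k + 1 : ℕ) : ℝ)
          + 2 * Real.sqrt (d * ρ) * Real.sqrt (k : ℝ)
          ≤ 2 * Real.sqrt (d * ρ) * Real.sqrt ((k + 1 : ℕ) : ℝ) := by
        have := mul_le_mul_of_nonneg_left hsq (mul_nonneg zero_le_two hq)
        refine le_of_eq_of_le ?_ this
        field_simp
        ring
      push_cast at ih' hfa hkey ⊢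
      linarith

end Eluder

/-! ### Exploration bonus: harmonic potential and Jensen -/

section Bonus

variable {A : Type*} [Fintype A]

open Classical in
/-- The number of rounds after the warm-up phase in which the action `a` occurs in `b`. -/
noncomputable def playCount {n : ℕ} (b : Fin n → A) (a : A) : ℕ :=
  ∑ j : Fin n, if Fintype.card A ≤ (j : ℕ) ∧ a = b j then 1 else 0

theorem playCount_le {n : ℕ} (b : Fin n → A) (a : A) : playCount b a ≤ n := by
  classical
  unfold playCount
  refine (Finset.sum_le_sum fun j _ => ?_ : _ ≤ ∑ _j : Fin n, 1).trans (by simp)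
  split_ifs <;> simp

open Classical in
theorem playCount_succ {n : ℕ} (b : Fin (n + 1) → A) (a : A) :
    playCount b a = playCount (fun j => b j.castSucc) a
      + if Fintype.card A ≤ n ∧ a = b (Fin.last n) then 1 else 0 := by
  unfold playCount
  rw [Fin.sum_univ_castSucc]
  simp

/-- One further draw moves the harmonic number of a single action, and by exactly the integrand of
the bonus of that round. -/
theorem sum_harmonic_playCount_succ {n : ℕ} (b : Fin (n + 1) → A) :
    ∑ a, (harmonic (playCount b a) : ℝ)
      = ∑ a, (harmonic (playCount (fun j => b j.castSucc) a) : ℝ)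
        + if Fintype.card A ≤ n then
            1 / ((playCount (fun j => b j.castSucc) (b (Fin.last n)) : ℝ) + 1) else 0 := by
  classical
  have h : ∀ a, (harmonic (playCount b a) : ℝ)
      = harmonic (playCount (fun j => b j.castSucc) a)
        + if a = b (Fin.last n) then (if Fintype.card A ≤ n then
            1 / ((playCount (fun j => b j.castSucc) a : ℝ) + 1) else 0) else 0 := by
    intro a
    rw [playCount_succ]
    by_cases h1 : Fintype.card A ≤ n <;> by_cases h2 : a = b (Fin.last n) <;>
      simp [h1, h2, harmonic_succ]
  simp_rw [h, Finset.sum_add_distrib, Finset.sum_ite_eq', Finset.mem_univ, if_true]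

variable [MeasurableSpace A]

theorem bonus_eq {n : ℕ} (ν : Fin n → Measure A) (π : Measure A) :
    bonus ν π = ∫ a, (∫ b : Fin n → A, 1 / ((playCount b a : ℝ) + 1) ∂(Measure.pi ν)) ∂π := by
  unfold bonus playCount
  simp

theorem bonus_nonneg {n : ℕ} (ν : Fin n → Measure A) (π : Measure A) : 0 ≤ bonus ν π := by
  rw [bonus_eq]
  exact integral_nonneg fun a => integral_nonneg fun b => by positivity

variable [DiscreteMeasurableSpace A]

/-- At a fixed context the counterfactual actions of all rounds live on one product space. There
each bonus is the expected increment of the potential `∑ₐ H(count of a)`, so the sum telescopes. -/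
theorem sum_bonus_eq (ν : ℕ → Measure A) [∀ n, IsProbabilityMeasure (ν n)] (T : ℕ) :
    ∑ n ∈ Finset.range T, (if Fintype.card A ≤ n then
        bonus (fun j : Fin n => ν j) (ν n) else 0)
      = ∫ b : Fin T → A, ∑ a, (harmonic (playCount b a) : ℝ)
          ∂(Measure.pi fun j : Fin T => ν j) := by
  induction T with
  | zero => simp [playCount]
  | succ n ih =>
    rw [Finset.sum_range_succ, ih]
    have hmp := measurePreserving_piFinSuccAbove (fun j : Fin (n + 1) => ν j) (Fin.last n)
    simp only [Fin.val_last, Fin.succAbove_last, Fin.val_castSucc] at hmp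
    simp_rw [sum_harmonic_playCount_succ]
    let Φ : A × (Fin n → A) → ℝ := fun q =>
      ∑ a, (harmonic (playCount q.2 a) : ℝ)
        + if Fintype.card A ≤ n then 1 / ((playCount q.2 q.1 : ℝ) + 1) else 0
    have h1 : ∫ b : Fin (n + 1) → A, Φ (MeasurableEquiv.piFinSuccAbove _ (Fin.last n) b)
        ∂(Measure.pi fun j : Fin (n + 1) => ν j)
        = ∫ q, Φ q ∂((ν n).prod (Measure.pi fun j : Fin n => ν j)) :=
      hmp.integral_comp' (g := Φ)
    have h2 : ∀ b : Fin (n + 1) → A, Φ (MeasurableEquiv.piFinSuccAbove _ (Fin.last n) b)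
        = ∑ a, (harmonic (playCount (fun j => b j.castSucc) a) : ℝ)
        + if Fintype.card A ≤ n then
            1 / ((playCount (fun j => b j.castSucc) (b (Fin.last n)) : ℝ) + 1) else 0 := by
      intro b
      simp [Φ, MeasurableEquiv.piFinSuccAbove, Fin.init_def]
    simp_rw [h2] at h1
    rw [h1, integral_prod _ Integrable.of_finite]
    simp only [Φ]
    have h3 : ∀ a : A, ∫ b : Fin n → A, (∑ a', (harmonic (playCount b a') : ℝ)
        + if Fintype.card A ≤ n then 1 / ((playCount b a : ℝ) + 1) else 0)
          ∂(Measure.pi fun j : Fin n => ν j)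
        = ∫ b : Fin n → A, ∑ a', (harmonic (playCount b a') : ℝ)
            ∂(Measure.pi fun j : Fin n => ν j)
          + ∫ b : Fin n → A, (if Fintype.card A ≤ n then 1 / ((playCount b a : ℝ) + 1) else 0)
            ∂(Measure.pi fun j : Fin n => ν j) := fun a =>
      integral_add Integrable.of_finite Integrable.of_finite
    simp_rw [h3]
    rw [integral_add Integrable.of_finite Integrable.of_finite, integral_const]
    simp only [probReal_univ, one_smul, add_right_inj]
    split_ifs
    · rw [bonus_eq]
    · simp

theorem sum_bonus_le (ν : ℕ → Measure A) [∀ n, IsProbabilityMeasure (ν n)] (T : ℕ) :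
    ∑ n ∈ Finset.range T, (if Fintype.card A ≤ n then
        bonus (fun j : Fin n => ν j) (ν n) else 0)
      ≤ Fintype.card A * (1 + Real.log T) := by
  rw [sum_bonus_eq]
  have h : ∀ b : Fin T → A, ∑ a, (harmonic (playCount b a) : ℝ)
      ≤ Fintype.card A * (1 + Real.log T) := by
    intro b
    have hm : Monotone harmonic := monotone_nat_of_le_succ fun n => by
      rw [harmonic_succ]; simp only [le_add_iff_nonneg_right]; positivity
    refine (Finset.sum_le_sum fun a _ => ?_ : _ ≤ ∑ _a : A, (1 + Real.log T)).trans
      (by rw [Finset.sum_const, nsmul_eq_mul, Finset.card_univ])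
    refine le_trans ?_ (harmonic_le_one_add_log T)
    exact_mod_cast hm (playCount_le b a)
  refine (integral_mono Integrable.of_finite Integrable.of_finite h).trans ?_
  simp

/-- Jensen's inequality for the exploration bonus. -/
theorem le_bonus {n : ℕ} (ν : Fin n → Measure A) [∀ j, IsProbabilityMeasure (ν j)]
    (π : Measure A) [IsProbabilityMeasure π] :
    ∑ a, π.real {a} * (1 / (1 + ∑ j : Fin n,
      if Fintype.card A ≤ (j : ℕ) then (ν j).real {a} else 0)) ≤ bonus ν π := by
  classical
  rw [bonus_eq, integral_fintype Integrable.of_finite]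
  refine Finset.sum_le_sum fun a _ => ?_
  rw [smul_eq_mul]
  refine mul_le_mul_of_nonneg_left ?_ measureReal_nonneg
  set s := ∑ j : Fin n, if Fintype.card A ≤ (j : ℕ) then (ν j).real {a} else 0 with hs
  have hs0 : 0 ≤ s := Finset.sum_nonneg fun j _ => by
    split_ifs
    · exact measureReal_nonneg
    · exact le_rfl
  have hmean : ∫ b : Fin n → A, (playCount b a : ℝ) ∂(Measure.pi ν) = s := by
    unfold playCount
    push_cast
    rw [integral_finsetSum _ fun j _ => Integrable.of_finite]
    refine Finset.sum_congr rfl fun j _ => ?_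
    by_cases hj : Fintype.card A ≤ (j : ℕ)
    · simp only [hj, true_and, if_true]
      have h1 := integral_map (measurePreserving_eval ν j).measurable.aemeasurable
        (μ := Measure.pi ν) (f := fun c : A => if a = c then (1 : ℝ) else 0)
        (StronglyMeasurable.of_discrete).aestronglyMeasurable
      rw [(measurePreserving_eval ν j).map_eq, integral_fintype Integrable.of_finite] at h1
      simpa using h1.symm
    · simp [hj]
  -- Tangent line of the convex function `k ↦ 1/(1+k)` at the mean `s`; its linear part integrates
  -- to zero.
  have htan : ∀ b : Fin n → A,
      1 / (1 + s) - ((playCount b a : ℝ) - s) / (1 + s) ^ 2 ≤ 1 / ((playCount b a : ℝ) + 1) := by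
    intro b
    set k : ℝ := (playCount b a : ℝ)
    have hk : 0 ≤ k := Nat.cast_nonneg _
    rw [div_sub_div _ _ (by positivity) (by positivity),
      div_le_div_iff₀ (by positivity) (by positivity)]
    nlinarith [mul_nonneg (by positivity : 0 ≤ 1 + s) (sq_nonneg (k - s))]
  calc 1 / (1 + s)
      = ∫ b : Fin n → A, (1 / (1 + s) - ((playCount b a : ℝ) - s) / (1 + s) ^ 2)
          ∂(Measure.pi ν) := by
        rw [integral_sub Integrable.of_finite Integrable.of_finite,
          integral_div ((1 + s) ^ 2), integral_sub Integrable.of_finite Integrable.of_finite,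
          hmean]
        simp
    _ ≤ _ := integral_mono Integrable.of_finite Integrable.of_finite htan

end Bonus

/-! ### Averages over actions and mixtures with a fixed action -/

section Averages

variable {X A Y : Type*} [MeasurableSpace X] [MeasurableSpace A] [MeasurableSpace Y]

theorem mem_members {F : Finset (Kernel (X × A) Y)} {f : Kernel (X × A) Y} (hf : f ∈ F)
    (p : X × A) : f p ∈ members F := ⟨f, hf, p, rfl⟩

theorem avg_dirac [DiscreteMeasurableSpace A] (T : Measure Y → ℝ) (f : Kernel (X × A) Y)
    (x : X) (a : A) : avg T f x (Measure.dirac a) = T (f (x, a)) := by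
  simp [avg]

/-- The distribution that plays `π` with probability `γ` and `a` otherwise. -/
noncomputable def mixDirac (γ : ℝ) (π : Measure A) (a : A) : Measure A :=
  ENNReal.ofReal γ • π + ENNReal.ofReal (1 - γ) • Measure.dirac a

theorem isProbabilityMeasure_mixDirac {γ : ℝ} (h0 : 0 ≤ γ) (h1 : γ ≤ 1) (π : Measure A)
    [IsProbabilityMeasure π] (a : A) : IsProbabilityMeasure (mixDirac γ π a) := by
  constructor
  simp only [mixDirac, Measure.coe_add, Measure.coe_smul, Pi.add_apply, Pi.smul_apply,
    measure_univ, smul_eq_mul, mul_one]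
  rw [← ENNReal.ofReal_add h0 (by linarith)]
  simp

variable [Fintype A] [DiscreteMeasurableSpace A]

theorem integral_mixDirac {γ : ℝ} (h0 : 0 ≤ γ) (h1 : γ ≤ 1) (π : Measure A)
    [IsProbabilityMeasure π] (a : A) (φ : A → ℝ) :
    ∫ b, φ b ∂(mixDirac γ π a) = γ * ∫ b, φ b ∂π + (1 - γ) * φ a := by
  unfold mixDirac
  rw [integral_add_measure (Integrable.of_finite.smul_measure ENNReal.ofReal_ne_top)
    (Integrable.of_finite.smul_measure ENNReal.ofReal_ne_top), integral_smul_measure,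
    integral_smul_measure, ENNReal.toReal_ofReal h0, ENNReal.toReal_ofReal (by linarith)]
  simp

theorem avg_eq_sum (T : Measure Y → ℝ) (f : Kernel (X × A) Y) (x : X) (π : Measure A)
    [IsProbabilityMeasure π] : avg T f x π = ∑ a, π.real {a} * T (f (x, a)) := by
  unfold avg
  rw [integral_fintype Integrable.of_finite]
  simp

theorem avg_mem_Icc {F : Finset (Kernel (X × A) Y)} {T : Measure Y → ℝ}
    (hT : ∀ ρ ∈ members F, T ρ ∈ Set.Icc (0 : ℝ) 1) {f : Kernel (X × A) Y} (hf : f ∈ F) (x : X)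
    (π : Measure A) [IsProbabilityMeasure π] : avg T f x π ∈ Set.Icc (0 : ℝ) 1 := by
  refine ⟨integral_nonneg fun a => (hT _ (mem_members hf _)).1, ?_⟩
  refine (integral_mono Integrable.of_finite Integrable.of_finite
    fun a => (hT _ (mem_members hf _)).2).trans ?_
  simp

end Averages

/-! ### Optimism and the regret of a single round -/

section Deterministic

variable {X A Y Z : Type*} [MeasurableSpace X] [MeasurableSpace A] [MeasurableSpace Y]
  [MeasurableSpace Z] {P : Problem X A Y Z} {L CD δ : ℝ}

/-- A context is required: `r₀ ≤ 1` is known only through `r₀` being a value of `T₁` at `(x, a₀)`.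
-/
theorem Problem.Valid.alpha_nonneg (hV : P.Valid L CD) (x : X) : 0 ≤ P.alpha := by
  have h := (hV.T₁_mem _ (mem_members hV.fstar_mem (x, P.a₀))).2
  rw [hV.safe_utility] at h
  exact div_nonneg (by linarith) (by linarith [hV.c₀_lt])

theorem Problem.Valid.C_nonneg (hV : P.Valid L CD) (x : X) : 0 ≤ P.C := by
  have h := mem_members hV.gstar_mem (x, P.a₀)
  have := hV.D₂_le _ h _ h
  rwa [hV.metric₂.self _ h] at this

theorem Problem.Valid.fhat_mem (hV : P.Valid L CD) {n : ℕ} (h : Hist X A Y Z n) :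
    P.fhat h ∈ P.F := hV.oracleF.mem _ _

theorem Problem.Valid.ghat_mem (hV : P.Valid L CD) {n : ℕ} (h : Hist X A Y Z n) :
    P.ghat h ∈ P.G := hV.oracleG.mem _ _

variable [DiscreteMeasurableSpace A]

theorem Problem.Valid.feasible_of_mem_feasSet (hV : P.Valid L CD) {n : ℕ} {h : Hist X A Y Z n}
    (hg : P.gstar ∈ P.confSet δ h) {x : X} {π : Measure A} (hπ : π ∈ P.feasSet δ h x) :
    avg P.T₂ P.gstar x π ≤ P.τ := by
  rcases hπ with hπ | hπ
  · exact hπ.2 _ hg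
  · rw [Set.mem_singleton_iff.1 hπ, avg_dirac, hV.safe_constraint]
    exact hV.c₀_lt.le

variable [Fintype A]

theorem Problem.Valid.bddAbove_width (hV : P.Valid L CD) {n : ℕ} (h : Hist X A Y Z n) (x : X)
    (π : Measure A) [IsProbabilityMeasure π] :
    BddAbove {r | ∃ g' ∈ P.confSet δ h, ∃ g'' ∈ P.confSet δ h,
      r = avg P.T₂ g' x π - avg P.T₂ g'' x π} := by
  refine ⟨1, ?_⟩
  rintro r ⟨g', hg', g'', hg'', rfl⟩
  have h1 := avg_mem_Icc hV.T₂_mem hg'.1 x π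
  have h2 := avg_mem_Icc hV.T₂_mem hg''.1 x π
  linarith [h1.2, h2.1]

theorem Problem.Valid.sub_le_width (hV : P.Valid L CD) {n : ℕ} {h : Hist X A Y Z n} (x : X)
    (π : Measure A) [IsProbabilityMeasure π] {g' g'' : Kernel (X × A) Z}
    (hg' : g' ∈ P.confSet δ h) (hg'' : g'' ∈ P.confSet δ h) :
    avg P.T₂ g' x π - avg P.T₂ g'' x π ≤ P.width δ h x π :=
  le_csSup (hV.bddAbove_width h x π) ⟨g', hg', g'', hg'', rfl⟩

theorem Problem.Valid.width_nonneg (hV : P.Valid L CD) {n : ℕ} {h : Hist X A Y Z n}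
    (hg : P.gstar ∈ P.confSet δ h) (x : X) (π : Measure A) [IsProbabilityMeasure π] :
    0 ≤ P.width δ h x π := by
  simpa using hV.sub_le_width x π hg hg

/-- All models of the confidence set take the value `c₀` at the safe action, so mixing with it
multiplies every difference by `γ`. -/
theorem Problem.Valid.mul_width_le_width_mixDirac (hV : P.Valid L CD) {n : ℕ}
    {h : Hist X A Y Z n} (hg : P.gstar ∈ P.confSet δ h) (x : X) (π : Measure A)
    [IsProbabilityMeasure π] {γ : ℝ} (h0 : 0 < γ) (h1 : γ ≤ 1) :
    γ * P.width δ h x π ≤ P.width δ h x (mixDirac γ π P.a₀) := by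
  have := isProbabilityMeasure_mixDirac h0.le h1 π P.a₀
  rw [← le_div_iff₀' h0]
  refine csSup_le ⟨_, P.gstar, hg, P.gstar, hg, rfl⟩ ?_
  rintro r ⟨g', hg', g'', hg'', rfl⟩
  rw [le_div_iff₀' h0]
  refine le_trans (le_of_eq ?_) (hV.sub_le_width x (mixDirac γ π P.a₀) hg' hg'')
  unfold avg
  rw [integral_mixDirac h0.le h1, integral_mixDirac h0.le h1, hg'.2.2 x, hg''.2.2 x]
  ring

/-- The total probability with which the earlier policies play the action `a` at the context
`x`. -/
noncomputable def expectedPlays (pol : (n : ℕ) → Kernel (Hist X A Y Z n × X) A) {n : ℕ}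
    (h : Hist X A Y Z n) (x : X) (a : A) : ℝ :=
  ∑ j : Fin n, (pol j (h.take j, x)).real {a}

/-- The residual of the confidence bound for the utility at the context `x`. -/
noncomputable def Problem.residual (P : Problem X A Y Z) (L δ : ℝ)
    (pol : (n : ℕ) → Kernel (Hist X A Y Z n × X) A) {n : ℕ} (h : Hist X A Y Z n) (x : X) : ℝ :=
  ∑ a, expectedPlays pol h x a * (P.T₁ (P.fhat h (x, a)) - P.T₁ (P.fstar (x, a))) ^ 2
    / (4 * P.beta L δ (n + 1))

variable {pol : (n : ℕ) → Kernel (Hist X A Y Z n × X) A}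

/-- The warm-up plays each action in exactly one round. It thus supplies the `1` in the denominator
of the bonus, and the total over all rounds is the quantity that Jensen produces. -/
theorem Problem.IsGEDUCB.expectedPlays_eq (hpol : P.IsGEDUCB L δ pol) {n : ℕ}
    (hn : Fintype.card A ≤ n) (h : Hist X A Y Z n) (x : X) (a : A) :
    expectedPlays pol h x a = 1 + ∑ j : Fin n,
      if Fintype.card A ≤ (j : ℕ) then (pol j (h.take j, x)).real {a} else 0 := by
  classical
  obtain ⟨e, he⟩ := hpol.warmup
  have hsplit : ∀ j : Fin n, (pol j (h.take j, x)).real {a}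
      = (if j = Fin.castLE hn (e.symm a) then 1 else 0)
        + if Fintype.card A ≤ (j : ℕ) then (pol j (h.take j, x)).real {a} else 0 := by
    intro j
    by_cases hj : (j : ℕ) < Fintype.card A
    · rw [he j hj, if_neg (not_le.2 hj), add_zero]
      have : (j = Fin.castLE hn (e.symm a)) ↔ e ⟨j, hj⟩ = a := by
        rw [← Equiv.eq_symm_apply, Fin.ext_iff, Fin.ext_iff]
        rfl
      simp only [this, measureReal_def, Measure.dirac_apply, Set.indicator_apply,
        Set.mem_singleton_iff]
      split_ifs <;> simp
    · rw [if_neg, if_pos (not_lt.1 hj), zero_add]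
      rintro rfl
      exact hj (e.symm a).2
  unfold expectedPlays
  rw [Finset.sum_congr rfl fun j _ => hsplit j, Finset.sum_add_distrib]
  simp

variable [∀ n, IsMarkovKernel (pol n)]

/-- AM-GM per action, `|Δ| ≤ β/N + NΔ²/(4β)`. In the second term the weight `π(a)` is bounded by
`1`, so that the residual is the same for every policy and can be used on both sides of the optimism
argument. -/
theorem Problem.IsGEDUCB.abs_avg_sub_le (hpol : P.IsGEDUCB L δ pol) {n : ℕ}
    (hn : Fintype.card A ≤ n) (hβ : 0 < P.beta L δ (n + 1)) (h : Hist X A Y Z n) (x : X)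
    (π : Measure A) [IsProbabilityMeasure π] :
    |avg P.T₁ (P.fhat h) x π - avg P.T₁ P.fstar x π|
      ≤ P.beta L δ (n + 1) * bonus (fun j : Fin n => pol j (h.take j, x)) π
        + P.residual L δ pol h x := by
  have hb := le_bonus (fun j : Fin n => pol j (h.take j, x)) π
  refine le_trans ?_ (add_le_add_left (mul_le_mul_of_nonneg_left hb hβ.le) _)
  rw [avg_eq_sum, avg_eq_sum, ← Finset.sum_sub_distrib]
  refine (Finset.abs_sum_le_sum_abs _ _).trans ?_
  unfold Problem.residual
  rw [Finset.mul_sum, ← Finset.sum_add_distrib]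
  refine Finset.sum_le_sum fun a _ => ?_
  rw [← hpol.expectedPlays_eq hn h x a]
  have hN : 1 ≤ expectedPlays pol h x a := by
    rw [hpol.expectedPlays_eq hn h x a]
    refine le_add_of_nonneg_right (Finset.sum_nonneg fun j _ => ?_)
    split_ifs
    · exact measureReal_nonneg
    · exact le_rfl
  set N := expectedPlays pol h x a
  set β := P.beta L δ (n + 1)
  set q := π.real {a} with hq
  have hq0 : 0 ≤ q := measureReal_nonneg
  have hq1 : q ≤ 1 := measureReal_le_one
  rw [← mul_sub, abs_mul, abs_of_nonneg hq0]
  set Δ := P.T₁ (P.fhat h (x, a)) - P.T₁ (P.fstar (x, a))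
  have hN0 : 0 < N := by linarith
  have h1 : |Δ| ≤ β / N + N * Δ ^ 2 / (4 * β) := by
    have h2 : 0 ≤ (2 * β - N * |Δ|) ^ 2 / (4 * β * N) := by positivity
    have h3 : (2 * β - N * |Δ|) ^ 2 / (4 * β * N) = β / N + N * Δ ^ 2 / (4 * β) - |Δ| := by
      rw [← sq_abs Δ]
      field_simp
      ring
    linarith
  have h4 : 0 ≤ N * Δ ^ 2 / (4 * β) := by positivity
  calc q * |Δ| ≤ q * (β / N + N * Δ ^ 2 / (4 * β)) := mul_le_mul_of_nonneg_left h1 hq0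
    _ = β * (q * (1 / N)) + q * (N * Δ ^ 2 / (4 * β)) := by ring
    _ ≤ β * (q * (1 / N)) + N * Δ ^ 2 / (4 * β) := by
      linarith [mul_le_mul_of_nonneg_right hq1 h4]

/-- Optimism: the upper confidence bound of the played policy dominates the utility of every
policy that satisfies the true constraint. -/
theorem Problem.IsGEDUCB.avg_le_ucb (hpol : P.IsGEDUCB L δ pol) (hV : P.Valid L CD) {n : ℕ}
    (hn : Fintype.card A ≤ n) (hβ : 0 < P.beta L δ (n + 1)) {h : Hist X A Y Z n}
    (hg : P.gstar ∈ P.confSet δ h) (x : X) (π : Measure A) [IsProbabilityMeasure π]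
    (hπ : avg P.T₂ P.gstar x π ≤ P.τ) :
    avg P.T₁ P.fstar x π ≤ P.ucb L δ pol h x (pol n (h, x)) + P.residual L δ pol h x := by
  set w := P.width δ h x π with hw
  have hw0 : 0 ≤ w := hV.width_nonneg hg x π
  have hc := hV.c₀_lt
  -- This weight solves `γ (τ + w) + (1 - γ) c₀ = τ`; models of the confidence set exceed `g*` by at
  -- most `w` at `π`, so the mixture is feasible for all of them.
  set γ := (P.τ - P.c₀) / (P.τ - P.c₀ + w) with hγ
  have hden : 0 < P.τ - P.c₀ + w := by linarith
  have hγ0 : 0 < γ := div_pos (by linarith) hden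
  have hγ1 : γ ≤ 1 := (div_le_one hden).2 (by linarith)
  have hγw : γ * (P.τ - P.c₀ + w) = P.τ - P.c₀ := div_mul_cancel₀ _ hden.ne'
  have hmixp := isProbabilityMeasure_mixDirac hγ0.le hγ1 π P.a₀
  set ρ := mixDirac γ π P.a₀ with hρ
  have hmem : ρ ∈ P.feasSet δ h x := by
    refine Or.inl ⟨hmixp, fun g hgc => ?_⟩
    have h1 := hV.sub_le_width x π hgc hg
    have h2 : avg P.T₂ g x ρ = γ * avg P.T₂ g x π + (1 - γ) * P.c₀ := by
      unfold avg
      rw [hρ, integral_mixDirac hγ0.le hγ1, hgc.2.2 x]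
    rw [h2]
    have h3 : γ * avg P.T₂ g x π ≤ γ * (P.τ + w) :=
      mul_le_mul_of_nonneg_left (by linarith) hγ0.le
    linarith
  have hucb := hpol.argmax n hn h x ρ hmem
  have hwid := hV.mul_width_le_width_mixDirac hg x π hγ0 hγ1
  have hα := hV.alpha_nonneg x
  -- The value of `α_r` is dictated here: the width bonus of the mixture pays for the utility lost
  -- by mixing, using that utilities are at most `1`.
  have hαw : P.alpha * (γ * w) = (1 - P.r₀) * (1 - γ) := by
    have h1 : γ * w = (P.τ - P.c₀) * (1 - γ) := by linarith
    rw [h1, Problem.alpha, ← mul_assoc, div_mul_cancel₀ _ (by linarith : P.τ - P.c₀ ≠ 0)]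
  have hconf := (abs_le.1 (hpol.abs_avg_sub_le hn hβ h x ρ)).1
  have hstar : avg P.T₁ P.fstar x ρ = γ * avg P.T₁ P.fstar x π + (1 - γ) * P.r₀ := by
    unfold avg
    rw [hρ, integral_mixDirac hγ0.le hγ1, hV.safe_utility]
  have hle1 := (avg_mem_Icc hV.T₁_mem hV.fstar_mem x π).2
  have h5 : (1 - γ) * avg P.T₁ P.fstar x π ≤ (1 - γ) * 1 :=
    mul_le_mul_of_nonneg_left hle1 (by linarith)
  have h6 := mul_le_mul_of_nonneg_left hwid hα
  rw [Problem.ucb] at hucb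
  linarith

/-- The factors `2` arise because the confidence bound is used twice: in the optimism argument and
at the played policy. -/
theorem Problem.IsGEDUCB.avg_sub_avg_le (hpol : P.IsGEDUCB L δ pol) (hV : P.Valid L CD) {n : ℕ}
    (hn : Fintype.card A ≤ n) (hβ : 0 < P.beta L δ (n + 1)) {h : Hist X A Y Z n}
    (hg : P.gstar ∈ P.confSet δ h) (x : X) (π : Measure A) [IsProbabilityMeasure π]
    (hπ : avg P.T₂ P.gstar x π ≤ P.τ) :
    avg P.T₁ P.fstar x π - avg P.T₁ P.fstar x (pol n (h, x))
      ≤ 2 * P.beta L δ (n + 1)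
          * bonus (fun j : Fin n => pol j (h.take j, x)) (pol n (h, x))
        + P.alpha * P.width δ h x (pol n (h, x)) + 2 * P.residual L δ pol h x := by
  have h1 := hpol.avg_le_ucb hV hn hβ hg x π hπ
  have h2 := (abs_le.1 (hpol.abs_avg_sub_le hn hβ h x (pol n (h, x)))).2
  rw [Problem.ucb] at h1
  linarith

end Deterministic

/-! ### Laws along the interaction and concentration -/

section Probability

/-- The kernel ignores the history, so the conditional law survives when the history is replaced by
a function of it. Each oracle sees only such a reduced history, without the other observation. -/
theorem map_compProd_prodMkLeft {α α' β γ : Type*} [MeasurableSpace α] [MeasurableSpace α']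
    [MeasurableSpace β] [MeasurableSpace γ] (ν : Measure (α × β)) [SFinite ν] (κ : Kernel β γ)
    [IsSFiniteKernel κ] {f : α → α'} (hf : Measurable f) :
    (ν ⊗ₘ Kernel.prodMkLeft α κ).map (fun q => ((f q.1.1, q.1.2), q.2))
      = (ν.map fun q => (f q.1, q.2)) ⊗ₘ Kernel.prodMkLeft α' κ := by
  ext s hs
  have h1 : Measurable fun q : (α × β) × γ => ((f q.1.1, q.1.2), q.2) := by fun_prop
  have h2 : Measurable fun q : α × β => (f q.1, q.2) := by fun_prop
  rw [Measure.map_apply h1 hs, Measure.compProd_apply (h1 hs), Measure.compProd_apply hs,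
    lintegral_map (Kernel.measurable_kernel_prodMk_left hs) h2]
  rfl

variable {X A Y Z Ω : Type*} [MeasurableSpace X] [MeasurableSpace A] [MeasurableSpace Y]
  [MeasurableSpace Z] [MeasurableSpace Ω] {P : Problem X A Y Z}
  {pol : (n : ℕ) → Kernel (Hist X A Y Z n × X) A} {μ : Measure Ω}
  {W : ℕ → Ω → X × A × Y × Z} {L CD δ : ℝ}

/-- The law of the context and action of round `n + 1` given the history. -/
noncomputable def Problem.roundKernel (P : Problem X A Y Z)
    (pol : (n : ℕ) → Kernel (Hist X A Y Z n × X) A) (n : ℕ) : Kernel (Hist X A Y Z n) (X × A) :=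
  Kernel.const _ P.Q ⊗ₖ pol n

instance [IsProbabilityMeasure P.Q] [∀ n, IsMarkovKernel (pol n)] (n : ℕ) :
    IsMarkovKernel (P.roundKernel pol n) := by
  unfold Problem.roundKernel; infer_instance

theorem measurable_hist (hW : ∀ n, Measurable (W n)) (n : ℕ) : Measurable (hist W n) :=
  measurable_pi_lambda _ fun i => hW i

theorem Hist.measurable_take {n : ℕ} (i : Fin n) :
    Measurable fun h : Hist X A Y Z n => h.take i :=
  measurable_pi_lambda _ fun _ => measurable_pi_apply _

theorem Problem.IsInteraction.map_context_action [IsProbabilityMeasure μ]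
    [IsProbabilityMeasure P.Q] (hI : P.IsInteraction pol μ W) (n : ℕ) :
    μ.map (fun ω => (hist W n ω, ((W n ω).1, (W n ω).2.1)))
      = (μ.map (hist W n)) ⊗ₘ P.roundKernel pol n := by
  have hW := hI.measurable
  have hh := measurable_hist hW n
  have h1 := hI.action n
  rw [hI.context n, ← Measure.compProd_const, ← Measure.compProd_assoc] at h1
  have h2 := congrArg (Measure.map MeasurableEquiv.prodAssoc) h1
  have hWn := hW n
  rw [Measure.map_map (MeasurableEquiv.measurable _) (by fun_prop),
    Measure.map_map (MeasurableEquiv.measurable _) (MeasurableEquiv.measurable _)] at h2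
  rw [MeasurableEquiv.self_comp_symm, Measure.map_id] at h2
  exact h2

theorem Problem.IsInteraction.isSampledFrom_utility [IsProbabilityMeasure μ]
    [IsMarkovKernel P.fstar] (hI : P.IsInteraction pol μ W) :
    IsSampledFrom P.fstar
      (μ.map fun ω i => (((W i ω).1, (W i ω).2.1), (W i ω).2.2.1)) := by
  intro i
  have hW := hI.measurable
  have hh := measurable_hist hW i
  have hWi := hW i
  have hV : Measurable fun ω (i : ℕ) => (((W i ω).1, (W i ω).2.1), (W i ω).2.2.1) :=
    measurable_pi_lambda _ fun i => by have := hW i; fun_prop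
  let f : Hist X A Y Z i → Fin i → (X × A) × Y :=
    fun h j => (((h j).1, (h j).2.1), (h j).2.2.1)
  have hf : Measurable f := by fun_prop
  have h := congrArg (Measure.map fun q => ((f q.1.1, q.1.2), q.2)) (hI.utility i)
  rw [map_compProd_prodMkLeft _ _ hf, Measure.map_map (by fun_prop) (by fun_prop),
    Measure.map_map (by fun_prop) (by fun_prop)] at h
  rw [Measure.map_map (by fun_prop) hV, Measure.map_map (by fun_prop) hV]
  exact h

theorem Problem.IsInteraction.isSampledFrom_constraint [IsProbabilityMeasure μ]
    [IsMarkovKernel P.gstar] (hI : P.IsInteraction pol μ W) :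
    IsSampledFrom P.gstar
      (μ.map fun ω i => (((W i ω).1, (W i ω).2.1), (W i ω).2.2.2)) := by
  intro i
  have hW := hI.measurable
  have hh := measurable_hist hW i
  have hWi := hW i
  have hV : Measurable fun ω (i : ℕ) => (((W i ω).1, (W i ω).2.1), (W i ω).2.2.2) :=
    measurable_pi_lambda _ fun i => by have := hW i; fun_prop
  let f : Hist X A Y Z i → Fin i → (X × A) × Z :=
    fun h j => (((h j).1, (h j).2.1), (h j).2.2.2)
  have hf : Measurable f := by fun_prop
  have h := congrArg (Measure.map fun q => ((f q.1.1, q.1.2), q.2)) (hI.constraint i)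
  rw [map_compProd_prodMkLeft _ _ hf, Measure.map_map (by fun_prop) (by fun_prop),
    Measure.map_map (by fun_prop) (by fun_prop)] at h
  rw [Measure.map_map (by fun_prop) hV, Measure.map_map (by fun_prop) hV]
  exact h

/-- The oracle guarantee along the interaction, for the utility model. -/
theorem Problem.IsInteraction.measure_radF_lt_le [IsProbabilityMeasure μ]
    (hI : P.IsInteraction pol μ W) (hV : P.Valid L CD) (n : ℕ) {η : ℝ} (h0 : 0 < η) (h1 : η < 1) :
    μ {ω | P.estF (n + 1) η < ∑ i : Fin n, P.D₁ (P.fhat (hist W n ω) ((W i ω).1, (W i ω).2.1))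
      (P.fstar ((W i ω).1, (W i ω).2.1)) ^ 2} ≤ ENNReal.ofReal η := by
  have := hV.markov_F _ hV.fstar_mem
  have hm : Measurable fun ω (i : ℕ) => (((W i ω).1, (W i ω).2.1), (W i ω).2.2.1) :=
    measurable_pi_lambda _ fun i => by have := hI.measurable i; fun_prop
  -- The outer-measure inequality for push-forwards makes measurability of the failure event
  -- unnecessary.
  exact (Measure.le_map_apply hm.aemeasurable _).trans (hV.oracleF.guarantee _
    (Measure.isProbabilityMeasure_map hm.aemeasurable) hI.isSampledFrom_utility n η h0 h1)

/-- The oracle guarantee along the interaction, for the constraint model. -/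
theorem Problem.IsInteraction.measure_radG_lt_le [IsProbabilityMeasure μ]
    (hI : P.IsInteraction pol μ W) (hV : P.Valid L CD) (n : ℕ) {η : ℝ} (h0 : 0 < η) (h1 : η < 1) :
    μ {ω | P.estG (n + 1) η < ∑ i : Fin n, P.D₂ (P.ghat (hist W n ω) ((W i ω).1, (W i ω).2.1))
      (P.gstar ((W i ω).1, (W i ω).2.1)) ^ 2} ≤ ENNReal.ofReal η := by
  have := hV.markov_G _ hV.gstar_mem
  have hm : Measurable fun ω (i : ℕ) => (((W i ω).1, (W i ω).2.1), (W i ω).2.2.2) :=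
    measurable_pi_lambda _ fun i => by have := hI.measurable i; fun_prop
  exact (Measure.le_map_apply hm.aemeasurable _).trans (hV.oracleG.guarantee _
    (Measure.isProbabilityMeasure_map hm.aemeasurable) hI.isSampledFrom_constraint n η h0 h1)

/-- A negative radius would be exceeded by every sum of squares, so the oracle would fail with
probability one, against `η < 1`. -/
theorem Problem.IsInteraction.estF_nonneg [IsProbabilityMeasure μ]
    (hI : P.IsInteraction pol μ W) (hV : P.Valid L CD) (n : ℕ) {η : ℝ} (h0 : 0 < η) (h1 : η < 1) :
    0 ≤ P.estF (n + 1) η := by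
  by_contra! hneg
  have h := hI.measure_radF_lt_le hV n h0 h1
  have huniv : {ω | P.estF (n + 1) η < ∑ i : Fin n,
      P.D₁ (P.fhat (hist W n ω) ((W i ω).1, (W i ω).2.1))
      (P.fstar ((W i ω).1, (W i ω).2.1)) ^ 2} = Set.univ :=
    Set.eq_univ_of_forall fun ω => hneg.trans_le (Finset.sum_nonneg fun _ _ => sq_nonneg _)
  rw [huniv, measure_univ] at h
  exact absurd (ENNReal.one_le_ofReal.1 h) (not_le.2 h1)

theorem Problem.IsInteraction.estG_nonneg [IsProbabilityMeasure μ]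
    (hI : P.IsInteraction pol μ W) (hV : P.Valid L CD) (n : ℕ) {η : ℝ} (h0 : 0 < η) (h1 : η < 1) :
    0 ≤ P.estG (n + 1) η := by
  by_contra! hneg
  have h := hI.measure_radG_lt_le hV n h0 h1
  have huniv : {ω | P.estG (n + 1) η < ∑ i : Fin n,
      P.D₂ (P.ghat (hist W n ω) ((W i ω).1, (W i ω).2.1))
      (P.gstar ((W i ω).1, (W i ω).2.1)) ^ 2} = Set.univ :=
    Set.eq_univ_of_forall fun ω => hneg.trans_le (Finset.sum_nonneg fun _ _ => sq_nonneg _)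
  rw [huniv, measure_univ] at h
  exact absurd (ENNReal.one_le_ofReal.1 h) (not_le.2 h1)

/-! ### Concentration of the conditional means of bounded nonnegative variables -/

theorem exp_neg_le_one_sub_half {x : ℝ} (h0 : 0 ≤ x) (h1 : x ≤ 1) :
    Real.exp (-x) ≤ 1 - x / 2 := by
  have h2 : (1 - x / 2)⁻¹ ≤ Real.exp x := by
    refine le_trans ?_ (Real.quadratic_le_exp_of_nonneg h0)
    rw [inv_le_iff_one_le_mul₀ (by linarith)]
    -- `(1 - x/2)(1 + x + x²/2) = 1 + x/2 - x³/4`.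
    nlinarith [mul_nonneg h0 h0]
  rw [Real.exp_neg]
  exact inv_le_of_inv_le₀ (by linarith) h2

theorem lintegral_exp_neg_le {α : Type*} [MeasurableSpace α] (ν : Measure α)
    [IsProbabilityMeasure ν] {φ : α → ℝ} (hφ : Measurable φ) (h0 : ∀ p, 0 ≤ φ p)
    (h1 : ∀ p, φ p ≤ 1) :
    ∫⁻ p, ENNReal.ofReal (Real.exp (-φ p)) ∂ν ≤ ENNReal.ofReal (Real.exp (-(∫ p, φ p ∂ν) / 2)) := by
  have hint : Integrable φ ν := Integrable.of_bound hφ.aestronglyMeasurable 1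
    (Filter.Eventually.of_forall fun p => by rw [Real.norm_of_nonneg (h0 p)]; exact h1 p)
  calc ∫⁻ p, ENNReal.ofReal (Real.exp (-φ p)) ∂ν
      ≤ ∫⁻ p, ENNReal.ofReal (1 - φ p / 2) ∂ν :=
        lintegral_mono fun p => ENNReal.ofReal_le_ofReal (exp_neg_le_one_sub_half (h0 p) (h1 p))
    _ = ENNReal.ofReal (∫ p, (1 - φ p / 2) ∂ν) :=
        (ofReal_integral_eq_lintegral_ofReal ((integrable_const _).sub (hint.div_const 2))
          (Filter.Eventually.of_forall fun p => by
            have := h1 p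
            simp only [Pi.zero_apply, Pi.sub_apply]
            linarith)).symm
    _ ≤ _ := by
        refine ENNReal.ofReal_le_ofReal ?_
        rw [integral_sub (integrable_const _) (hint.div_const 2), integral_div]
        simp only [integral_const, probReal_univ, smul_eq_mul, mul_one]
        have := Real.add_one_le_exp (-(∫ p, φ p ∂ν) / 2)
        linarith

variable [∀ n, IsMarkovKernel (pol n)]

theorem measurable_integral_roundKernel [IsProbabilityMeasure P.Q] {n : ℕ}
    {φ : Hist X A Y Z n × (X × A) → ℝ} (hφ : Measurable φ) :
    Measurable fun h => ∫ p, φ (h, p) ∂(P.roundKernel pol n h) :=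
  (StronglyMeasurable.integral_kernel_prod_right (f := fun h p => φ (h, p))
    hφ.stronglyMeasurable).measurable

/-- Supermartingale induction: given the history, the last factor has mean at most one, because `E
e^{-φ} ≤ 1 - m/2 ≤ e^{-m/2}` when `φ` has values in `[0, 1]` and conditional mean `m`. -/
theorem Problem.IsInteraction.lintegral_exp_sum_le_one [IsProbabilityMeasure μ]
    [IsProbabilityMeasure P.Q] (hI : P.IsInteraction pol μ W)
    (φ : (n : ℕ) → Hist X A Y Z n × (X × A) → ℝ) (hφ : ∀ n, Measurable (φ n))
    (h0 : ∀ n q, 0 ≤ φ n q) (h1 : ∀ n q, φ n q ≤ 1) (N : ℕ) :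
    ∫⁻ ω, ENNReal.ofReal (Real.exp (∑ n ∈ Finset.range N,
      ((∫ p, φ n (hist W n ω, p) ∂(P.roundKernel pol n (hist W n ω))) / 2
        - φ n (hist W n ω, ((W n ω).1, (W n ω).2.1))))) ∂μ ≤ 1 := by
  induction N with
  | zero => simp
  | succ N ih =>
    refine le_trans ?_ ih
    let m : (n : ℕ) → Hist X A Y Z n → ℝ := fun n h => ∫ p, φ n (h, p) ∂(P.roundKernel pol n h)
    have hm : ∀ n, Measurable (m n) := fun n => measurable_integral_roundKernel (hφ n)
    let G : Hist X A Y Z N → ℝ := fun h => ∑ j : Fin N,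
      (m j (h.take j) / 2 - φ j (h.take j, ((h j).1, (h j).2.1)))
    have hG : Measurable G := by
      refine Finset.measurable_sum _ fun j _ => ?_
      refine (((hm j).comp (Hist.measurable_take j)).div_const 2).sub ((hφ j).comp ?_)
      exact (Hist.measurable_take j).prodMk (by fun_prop)
    have hGs : ∀ ω, ∑ n ∈ Finset.range N,
        (m n (hist W n ω) / 2 - φ n (hist W n ω, ((W n ω).1, (W n ω).2.1)))
        = G (hist W N ω) := fun ω => Finset.sum_range _
    have hWN := hI.measurable N
    have hh := measurable_hist hI.measurable N
    let Ψ : Hist X A Y Z N × (X × A) → ENNReal := fun q =>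
      ENNReal.ofReal (Real.exp (G q.1 + m N q.1 / 2)) * ENNReal.ofReal (Real.exp (-φ N q))
    have hΨ : Measurable Ψ := by
      have := hm N
      have := hφ N
      fun_prop
    calc _ = ∫⁻ ω, Ψ (hist W N ω, ((W N ω).1, (W N ω).2.1)) ∂μ := by
          refine lintegral_congr fun ω => ?_
          simp only [Ψ]
          rw [← ENNReal.ofReal_mul (Real.exp_pos _).le, ← Real.exp_add, Finset.sum_range_succ,
            ← hGs ω]
          simp only [m]
          congr 2
          ring
      _ = ∫⁻ q, Ψ q ∂((μ.map (hist W N)) ⊗ₘ P.roundKernel pol N) := by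
          rw [← hI.map_context_action N, lintegral_map hΨ (by fun_prop)]
      _ = ∫⁻ h, ∫⁻ p, Ψ (h, p) ∂(P.roundKernel pol N h) ∂(μ.map (hist W N)) :=
          Measure.lintegral_compProd hΨ
      _ ≤ ∫⁻ h, ENNReal.ofReal (Real.exp (G h)) ∂(μ.map (hist W N)) := by
          refine lintegral_mono fun h => ?_
          simp only [Ψ]
          have hφh : Measurable fun p => φ N (h, p) := (hφ N).comp measurable_prodMk_left
          rw [lintegral_const_mul _ (by fun_prop)]
          refine (mul_le_mul_right (lintegral_exp_neg_le _ hφh (fun p => h0 N _)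
            (fun p => h1 N _)) _).trans ?_
          rw [← ENNReal.ofReal_mul (Real.exp_pos _).le, ← Real.exp_add]
          refine le_of_eq ?_
          simp only [m]
          congr 2
          ring
      _ = ∫⁻ ω, ENNReal.ofReal (Real.exp (G (hist W N ω))) ∂μ :=
          lintegral_map (by fun_prop) hh
      _ = _ := by simp_rw [← hGs]; rfl

/-- With probability at least `1 - η`, the sum of the conditional means of nonnegative variables
bounded by `B` is at most twice the sum of the variables plus `2 B log (1 / η)`. -/
theorem Problem.IsInteraction.measure_sum_integral_gt_le [IsProbabilityMeasure μ]
    [IsProbabilityMeasure P.Q] (hI : P.IsInteraction pol μ W)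
    (φ : (n : ℕ) → Hist X A Y Z n × (X × A) → ℝ) (hφ : ∀ n, Measurable (φ n)) {B : ℝ}
    (hB : 0 ≤ B) (h0 : ∀ n q, 0 ≤ φ n q) (h1 : ∀ n q, φ n q ≤ B) (N : ℕ) {η : ℝ} (hη : 0 < η) :
    μ {ω | 2 * (∑ n ∈ Finset.range N, φ n (hist W n ω, ((W n ω).1, (W n ω).2.1))
        + B * Real.log (1 / η))
      < ∑ n ∈ Finset.range N, ∫ p, φ n (hist W n ω, p) ∂(P.roundKernel pol n (hist W n ω))}
      ≤ ENNReal.ofReal η := by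
  rcases hB.eq_or_lt with rfl | hB
  -- For `B = 0` rescaling by `B` is impossible, but the event reads `0 < 0`.
  · have hz : ∀ n q, φ n q = 0 := fun n q => le_antisymm (h1 n q) (h0 n q)
    simp [hz]
  · have hexp := hI.lintegral_exp_sum_le_one (fun n q => φ n q / B) (fun n => (hφ n).div_const B)
      (fun n q => div_nonneg (h0 n q) hB.le) (fun n q => (div_le_one hB).2 (h1 n q)) N
    set Z : Ω → ℝ := fun ω => ∑ n ∈ Finset.range N,
      ((∫ p, φ n (hist W n ω, p) / B ∂(P.roundKernel pol n (hist W n ω))) / 2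
        - φ n (hist W n ω, ((W n ω).1, (W n ω).2.1)) / B) with hZ
    have hZm : Measurable Z := by
      refine Finset.measurable_sum _ fun n _ => ?_
      have hh := measurable_hist hI.measurable n
      have hWn := hI.measurable n
      refine (((measurable_integral_roundKernel ((hφ n).div_const B)).comp hh).div_const 2).sub ?_
      exact ((hφ n).comp (by fun_prop)).div_const B
    have hsub : {ω | 2 * (∑ n ∈ Finset.range N, φ n (hist W n ω, ((W n ω).1, (W n ω).2.1))
          + B * Real.log (1 / η))
        < ∑ n ∈ Finset.range N, ∫ p, φ n (hist W n ω, p) ∂(P.roundKernel pol n (hist W n ω))}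
        ⊆ {ω | ENNReal.ofReal (1 / η) ≤ ENNReal.ofReal (Real.exp (Z ω))} := by
      intro ω hω
      rw [Set.mem_ofPred_eq] at hω ⊢
      refine ENNReal.ofReal_le_ofReal ?_
      rw [← Real.log_le_iff_le_exp (by positivity)]
      have hZB : Z ω = ((∑ n ∈ Finset.range N,
          ∫ p, φ n (hist W n ω, p) ∂(P.roundKernel pol n (hist W n ω))) / 2
          - ∑ n ∈ Finset.range N, φ n (hist W n ω, ((W n ω).1, (W n ω).2.1))) / B := by
        simp only [hZ, integral_div, Finset.sum_sub_distrib, Finset.sum_div, sub_div]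
        congr 1
        exact Finset.sum_congr rfl fun n _ => by ring
      rw [hZB, le_div_iff₀ hB]
      linarith
    -- Markov's inequality at the level `1/η`.
    have hmk := mul_meas_ge_le_lintegral (μ := μ) (f := fun ω => ENNReal.ofReal (Real.exp (Z ω)))
      (by fun_prop) (ENNReal.ofReal (1 / η))
    have hle := (mul_le_mul_right (measure_mono hsub) (ENNReal.ofReal (1 / η))).trans
      (hmk.trans hexp)
    rw [show ENNReal.ofReal (1 / η) = (ENNReal.ofReal η)⁻¹ by
      rw [one_div, ENNReal.ofReal_inv_of_pos hη], mul_comm, ← div_eq_mul_inv] at hle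
    rwa [ENNReal.div_le_iff (by simpa using hη) ENNReal.ofReal_ne_top, one_mul] at hle

end Probability

/-! ### Diameter of the confidence sets -/

section ConfidenceWidth

variable {X A Y Z : Type*} [MeasurableSpace X] [MeasurableSpace A] [MeasurableSpace Y]
  [MeasurableSpace Z] {P : Problem X A Y Z} {L CD δ : ℝ}

open Classical in
/-- The largest divergence, at a context-action pair, between two models of the confidence set. -/
noncomputable def Problem.confDiam (P : Problem X A Y Z) (hG : P.G.Nonempty) (δ : ℝ) {n : ℕ}
    (q : Hist X A Y Z n × (X × A)) : ℝ :=
  (P.G ×ˢ P.G).sup' (hG.product hG) fun g =>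
    if g.1 ∈ P.confSet δ q.1 ∧ g.2 ∈ P.confSet δ q.1 then P.D₂ (g.1 q.2) (g.2 q.2) else 0

/-- Split according to the finitely many values of `ĝᵗ`; the condition at the safe action does not
involve the history. -/
theorem Problem.Valid.measurableSet_mem_confSet (hV : P.Valid L CD) {n : ℕ}
    {g : Kernel (X × A) Z} (hg : g ∈ P.G) :
    MeasurableSet {h : Hist X A Y Z n | g ∈ P.confSet δ h} := by
  have heq : {h : Hist X A Y Z n | g ∈ P.confSet δ h} = ⋃ g₀ ∈ P.G,
      ({h | P.ghat h = g₀} ∩ {h | ∑ i, P.D₂ (g₀ ((h i).1, (h i).2.1)) (g ((h i).1, (h i).2.1)) ^ 2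
        ≤ P.radG δ (n + 1)}) ∩ {_h | ∀ x, P.T₂ (g (x, P.a₀)) = P.c₀} := by
    ext h
    simp only [Problem.confSet, Set.mem_ofPred_eq, Set.mem_iUnion, Set.mem_inter_iff]
    constructor
    · rintro ⟨-, h1, h2⟩
      exact ⟨P.ghat h, hV.ghat_mem h, ⟨rfl, h1⟩, h2⟩
    · rintro ⟨g₀, -, ⟨rfl, h1⟩, h2⟩
      exact ⟨hg, h1, h2⟩
  rw [heq]
  refine Finset.measurableSet_biUnion _ fun g₀ hg₀ => ?_
  refine (MeasurableSet.inter ?_ ?_).inter (MeasurableSet.const _)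
  · have hm : Measurable fun (h : Hist X A Y Z n) (i : Fin n) =>
        (((h i).1, (h i).2.1), (h i).2.2.2) := by fun_prop
    exact hm (hV.oracleG.measurable n g₀ hg₀)
  · refine measurableSet_le (Finset.measurable_sum _ fun i _ => ?_) measurable_const
    have hp : Measurable fun h : Hist X A Y Z n => ((h i).1, (h i).2.1) := by fun_prop
    exact ((hV.meas_D₂ g₀ hg₀ g hg).comp hp).pow_const 2

theorem Problem.Valid.measurable_confDiam (hV : P.Valid L CD) (hG : P.G.Nonempty) (n : ℕ) :
    Measurable (P.confDiam hG δ (n := n)) := by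
  classical
  have heq : P.confDiam hG δ (n := n) = (P.G ×ˢ P.G).sup' (hG.product hG) fun g q =>
      if g.1 ∈ P.confSet δ q.1 ∧ g.2 ∈ P.confSet δ q.1 then P.D₂ (g.1 q.2) (g.2 q.2) else 0 := by
    ext q
    rw [Problem.confDiam, Finset.sup'_apply]
  rw [heq]
  refine Finset.measurable_sup' _ fun g hg => ?_
  obtain ⟨hg1, hg2⟩ := Finset.mem_product.1 hg
  refine Measurable.ite ?_ ((hV.meas_D₂ _ hg1 _ hg2).comp measurable_snd) measurable_const
  exact measurable_fst ((hV.measurableSet_mem_confSet hg1).inter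
    (hV.measurableSet_mem_confSet hg2))

theorem Problem.div_le_confDiam (hG : P.G.Nonempty) {n : ℕ} {h : Hist X A Y Z n}
    {g' g'' : Kernel (X × A) Z} (hg' : g' ∈ P.confSet δ h) (hg'' : g'' ∈ P.confSet δ h)
    (p : X × A) : P.D₂ (g' p) (g'' p) ≤ P.confDiam hG δ (h, p) := by
  classical
  have h1 := Finset.le_sup' (s := P.G ×ˢ P.G) (f := fun g : Kernel (X × A) Z × Kernel (X × A) Z =>
    if g.1 ∈ P.confSet δ h ∧ g.2 ∈ P.confSet δ h then P.D₂ (g.1 p) (g.2 p) else 0)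
    (b := (g', g'')) (Finset.mem_product.2 ⟨hg'.1, hg''.1⟩)
  rw [if_pos ⟨hg', hg''⟩] at h1
  exact h1

theorem Problem.confDiam_cases (hG : P.G.Nonempty) {n : ℕ} (h : Hist X A Y Z n) (p : X × A) :
    P.confDiam hG δ (h, p) = 0 ∨ ∃ g' ∈ P.confSet δ h, ∃ g'' ∈ P.confSet δ h,
      P.confDiam hG δ (h, p) = P.D₂ (g' p) (g'' p) := by
  classical
  unfold Problem.confDiam
  obtain ⟨g, hg, heq⟩ := Finset.exists_mem_eq_sup' (hG.product hG)
    (fun g : Kernel (X × A) Z × Kernel (X × A) Z =>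
    if g.1 ∈ P.confSet δ h ∧ g.2 ∈ P.confSet δ h then P.D₂ (g.1 p) (g.2 p) else 0)
  by_cases hc : g.1 ∈ P.confSet δ h ∧ g.2 ∈ P.confSet δ h
  · rw [if_pos hc] at heq
    exact Or.inr ⟨g.1, hc.1, g.2, hc.2, heq⟩
  · rw [if_neg hc] at heq
    exact Or.inl heq

theorem Problem.Valid.confDiam_nonneg (hV : P.Valid L CD) (hG : P.G.Nonempty) {n : ℕ}
    (q : Hist X A Y Z n × (X × A)) : 0 ≤ P.confDiam hG δ q := by
  rcases P.confDiam_cases (δ := δ) hG q.1 q.2 with h | ⟨g', hg', g'', hg'', h⟩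
  · exact h.ge
  · exact (hV.metric₂.nonneg _ (mem_members hg'.1 _) _ (mem_members hg''.1 _)).trans h.ge

theorem Problem.Valid.confDiam_le (hV : P.Valid L CD) (hG : P.G.Nonempty) {n : ℕ}
    (q : Hist X A Y Z n × (X × A)) : P.confDiam hG δ q ≤ P.C := by
  rcases P.confDiam_cases (δ := δ) hG q.1 q.2 with h | ⟨g', hg', g'', hg'', h⟩
  · exact h.le.trans (hV.C_nonneg q.2.1)
  · exact h.le.trans (hV.D₂_le _ (mem_members hg'.1 _) _ (mem_members hg''.1 _))

/-- Triangle inequality through `ĝᵗ`; then `(u + v)² ≤ 2u² + 2v²` yields the factor `4 CD²`. -/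
theorem Problem.Valid.sum_sq_div_le (hV : P.Valid L CD) {n : ℕ} {h : Hist X A Y Z n}
    {g' g'' : Kernel (X × A) Z} (hg' : g' ∈ P.confSet δ h) (hg'' : g'' ∈ P.confSet δ h) :
    ∑ i, P.D₂ (g' ((h i).1, (h i).2.1)) (g'' ((h i).1, (h i).2.1)) ^ 2
      ≤ 4 * CD ^ 2 * P.radG δ (n + 1) := by
  have hterm : ∀ i, P.D₂ (g' ((h i).1, (h i).2.1)) (g'' ((h i).1, (h i).2.1)) ^ 2
      ≤ 2 * CD ^ 2 * (P.D₂ (P.ghat h ((h i).1, (h i).2.1)) (g' ((h i).1, (h i).2.1)) ^ 2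
        + P.D₂ (P.ghat h ((h i).1, (h i).2.1)) (g'' ((h i).1, (h i).2.1)) ^ 2) := by
    intro i
    set p := ((h i).1, (h i).2.1)
    have m' := mem_members hg'.1 p
    have m'' := mem_members hg''.1 p
    have mh := mem_members (hV.ghat_mem h) p
    have h1 := hV.metric₂.triangle _ m' _ mh _ m''
    rw [hV.metric₂.symm _ m' _ mh] at h1
    have h2 := pow_le_pow_left₀ (hV.metric₂.nonneg _ m' _ m'') h1 2
    refine h2.trans ?_
    nlinarith [mul_nonneg (sq_nonneg CD)
      (sq_nonneg (P.D₂ (P.ghat h p) (g' p) - P.D₂ (P.ghat h p) (g'' p)))]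
  refine (Finset.sum_le_sum fun i _ => hterm i).trans ?_
  rw [← Finset.mul_sum, Finset.sum_add_distrib]
  have := mul_le_mul_of_nonneg_left (add_le_add hg'.2.1 hg''.2.1)
    (by positivity : 0 ≤ 2 * CD ^ 2)
  linarith

/-- The widths of the confidence sets at the observed pairs are summable at the rate given by the
eluder dimension. -/
theorem Problem.Valid.sum_confDiam_le {Ω : Type*} (hV : P.Valid L CD) (hG : P.G.Nonempty)
    {T : ℕ} (hT : 1 ≤ T) (hmono : MonotoneOn (P.radG δ) (Set.Icc 1 T)) (hrad : 0 ≤ P.radG δ T)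
    (W : ℕ → Ω → X × A × Y × Z) (ω : Ω) (S : Finset ℕ) (hS : S ⊆ Finset.range T) :
    ∑ n ∈ S, P.confDiam hG δ (hist W n ω, ((W n ω).1, (W n ω).2.1))
      ≤ 1 / (T : ℝ) + P.C * min (T : ℝ) (eluderDim P.G P.D₂ (1 / (T : ℝ) ^ 2)).toNat
        + 4 * |CD| * Real.sqrt
          ((eluderDim P.G P.D₂ (1 / (T : ℝ) ^ 2)).toNat * P.radG δ T * T) := by
  have hTpos : (0 : ℝ) < T := by exact_mod_cast hT
  set d := (eluderDim P.G P.D₂ (1 / (T : ℝ) ^ 2)).toNat with hd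
  have hε₀ : 0 < 1 / (T : ℝ) ^ 2 := by positivity
  have hρ : 0 ≤ 4 * CD ^ 2 * P.radG δ T := by positivity
  have hsum := sum_le_of_card_filter_le
    (fun n => P.confDiam hG δ (hist W n ω, ((W n ω).1, (W n ω).2.1))) (C := P.C) (d := d)
    hε₀.le hρ S (fun n _ => hV.confDiam_le hG _) (fun ε hε => by
      refine card_le_eluderDim (ε₀ := 1 / (T : ℝ) ^ 2) (G := P.G) (D := P.D₂) hε.le
        (hε₀.trans hε) hρ (fun n => ((W n ω).1, (W n ω).2.1)) _ fun t ht => ?_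
      obtain ⟨htS, htε⟩ := Finset.mem_filter.1 ht
      have htT := Finset.mem_range.1 (hS htS)
      rcases P.confDiam_cases (δ := δ) hG (hist W t ω) ((W t ω).1, (W t ω).2.1) with
        h | ⟨g', hg', g'', hg'', h⟩
      · rw [h] at htε
        linarith
      · refine ⟨g', hg'.1, g'', hg''.1, ?_, h ▸ htε⟩
        rw [Finset.sum_range]
        refine (hV.sum_sq_div_le hg' hg'').trans ?_
        -- Monotone radii allow a single `ρ`, that of round `T`, for all rounds. Index `t` is round
        -- `t + 1`.
        have := hmono (a := t + 1) ⟨by omega, by omega⟩ (b := T) ⟨hT, le_rfl⟩ (by omega)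
        gcongr)
  have hcard : S.card ≤ T := by simpa using Finset.card_le_card hS
  refine hsum.trans (add_le_add (add_le_add ?_ ?_) ?_)
  · calc (S.card : ℝ) * (1 / (T : ℝ) ^ 2) ≤ T * (1 / (T : ℝ) ^ 2) := by gcongr
      _ = 1 / (T : ℝ) := by field_simp
  · have hC := hV.C_nonneg (W 0 ω).1
    refine mul_le_mul_of_nonneg_left ?_ hC
    push_cast
    gcongr
  · have h1 : Real.sqrt ((S.card - d : ℕ) : ℝ) ≤ Real.sqrt T := by
      refine Real.sqrt_le_sqrt ?_
      exact_mod_cast (Nat.sub_le _ _).trans hcard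
    have h2 : Real.sqrt (d * (4 * CD ^ 2 * P.radG δ T))
        = 2 * |CD| * Real.sqrt (d * P.radG δ T) := by
      have : (d * (4 * CD ^ 2 * P.radG δ T) : ℝ) = (2 * |CD|) ^ 2 * (d * P.radG δ T) := by
        rw [mul_pow, sq_abs]; ring
      rw [this, Real.sqrt_mul (by positivity), Real.sqrt_sq (by positivity)]
    rw [h2, Real.sqrt_mul (by positivity : 0 ≤ d * P.radG δ T)]
    calc 2 * (2 * |CD| * Real.sqrt (d * P.radG δ T)) * Real.sqrt ((S.card - d : ℕ) : ℝ)
        ≤ 2 * (2 * |CD| * Real.sqrt (d * P.radG δ T)) * Real.sqrt T := by gcongr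
      _ = _ := by ring

/-- Any pair with a larger diameter is by itself an eluder sequence of length one. Needed because
for dimension zero the `min {T, d}` term vanishes and cannot absorb a concentration error. -/
theorem Problem.confDiam_le_of_eluderDim_eq_zero (hG : P.G.Nonempty)
    {ε : ℝ} (hε : 0 < ε) (hd : (eluderDim P.G P.D₂ ε).toNat = 0) {n : ℕ}
    (q : Hist X A Y Z n × (X × A)) : P.confDiam hG δ q ≤ ε := by
  by_contra! hlt
  rcases P.confDiam_cases (δ := δ) hG q.1 q.2 with h | ⟨g', hg', g'', hg'', h⟩
  · have : P.confDiam hG δ q = 0 := h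
    linarith
  · have h1 : ε < P.D₂ (g' q.2) (g'' q.2) := hlt.trans_eq h
    have h2 := card_le_eluderDim (G := P.G) (D := P.D₂) le_rfl hε le_rfl
      (fun _ => q.2) {0} (fun t ht => by
        rw [Finset.mem_singleton.1 ht]
        exact ⟨g', hg'.1, g'', hg''.1, by simp, h1⟩)
    rw [hd] at h2
    norm_num at h2

variable [Fintype A] [DiscreteMeasurableSpace A]

/-- The maximum over models is moved inside the average over actions. The right side then integrates
over `x` to the conditional mean of a quantity evaluated at the realised pair, to which
concentration applies. -/
theorem Problem.Valid.width_le (hV : P.Valid L CD) (hG : P.G.Nonempty) {n : ℕ}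
    {h : Hist X A Y Z n} (hg : P.gstar ∈ P.confSet δ h) (x : X) (π : Measure A)
    [IsProbabilityMeasure π] :
    P.width δ h x π ≤ |L| * ∑ a, π.real {a} * P.confDiam hG δ (h, (x, a)) := by
  refine csSup_le ⟨_, P.gstar, hg, P.gstar, hg, rfl⟩ ?_
  rintro r ⟨g', hg', g'', hg'', rfl⟩
  rw [avg_eq_sum, avg_eq_sum, ← Finset.sum_sub_distrib, Finset.mul_sum]
  refine Finset.sum_le_sum fun a _ => ?_
  have m' := mem_members hg'.1 (x, a)
  have m'' := mem_members hg''.1 (x, a)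
  have h1 := (le_abs_self _).trans (hV.lip₂ _ m' _ m'')
  have h2 := mul_le_mul_of_nonneg_right (le_abs_self L) (hV.metric₂.nonneg _ m' _ m'')
  have h3 := mul_le_mul_of_nonneg_left (P.div_le_confDiam hG hg' hg'' (x, a))
    (abs_nonneg L)
  rw [← mul_sub]
  calc _ ≤ π.real {a} * (|L| * P.confDiam hG δ (h, (x, a))) :=
        mul_le_mul_of_nonneg_left (by linarith) measureReal_nonneg
    _ = _ := by ring

end ConfidenceWidth

/-! ### Integration over the context -/

section Integrals

variable {X A Y Z : Type*} [MeasurableSpace X] [MeasurableSpace A] [MeasurableSpace Y]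
  [MeasurableSpace Z] {P : Problem X A Y Z} {L CD δ : ℝ}

theorem Problem.Valid.abs_sq_sub_le (hV : P.Valid L CD) {f : Kernel (X × A) Y} (hf : f ∈ P.F)
    (p : X × A) : |(P.T₁ (f p) - P.T₁ (P.fstar p)) ^ 2| ≤ 1 := by
  have h1 := hV.T₁_mem _ (mem_members hf p)
  have h2 := hV.T₁_mem _ (mem_members hV.fstar_mem p)
  rw [abs_of_nonneg (sq_nonneg _), sq_le_one_iff_abs_le_one, abs_le]
  constructor <;> linarith [h1.1, h1.2, h2.1, h2.2]

theorem Problem.Valid.measurable_sq_sub (hV : P.Valid L CD) {f : Kernel (X × A) Y}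
    (hf : f ∈ P.F) : Measurable fun p => (P.T₁ (f p) - P.T₁ (P.fstar p)) ^ 2 :=
  ((hV.meas_T₁ f hf).sub (hV.meas_T₁ _ hV.fstar_mem)).pow_const 2

variable [Fintype A]

theorem Problem.residual_eq (pol : (n : ℕ) → Kernel (Hist X A Y Z n × X) A) {n : ℕ}
    (h : Hist X A Y Z n) (x : X) :
    P.residual L δ pol h x = (∑ j : Fin n, ∑ a, (pol j (h.take j, x)).real {a}
      * (P.T₁ (P.fhat h (x, a)) - P.T₁ (P.fstar (x, a))) ^ 2) / (4 * P.beta L δ (n + 1)) := by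
  unfold Problem.residual expectedPlays
  rw [Finset.sum_comm, Finset.sum_div]
  simp_rw [Finset.sum_mul]

variable [DiscreteMeasurableSpace A]

theorem integrable_sum_kernel_real {Q : Measure X} [IsProbabilityMeasure Q] (κ : Kernel X A)
    [IsMarkovKernel κ] {φ : X × A → ℝ} (hφ : Measurable φ) {B : ℝ} (hB : ∀ p, |φ p| ≤ B) :
    Integrable (fun x => ∑ a, (κ x).real {a} * φ (x, a)) Q := by
  refine integrable_finsetSum _ fun a _ => ?_
  refine Integrable.of_bound (C := B) ?_ (Filter.Eventually.of_forall fun x => ?_)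
  · refine Measurable.aestronglyMeasurable (Measurable.mul ?_ ?_)
    · exact (κ.measurable_coe (measurableSet_singleton a)).ennreal_toReal
    · exact hφ.comp (by fun_prop)
  · rw [Real.norm_eq_abs, abs_mul, abs_of_nonneg measureReal_nonneg]
    have h1 : (κ x).real {a} ≤ 1 := measureReal_le_one
    have h2 := hB (x, a)
    have h3 := abs_nonneg (φ (x, a))
    nlinarith

theorem integrable_avg {Q : Measure X} [IsProbabilityMeasure Q] (κ : Kernel X A)
    [IsMarkovKernel κ] {F : Finset (Kernel (X × A) Y)} {T : Measure Y → ℝ}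
    (hT : ∀ ρ ∈ members F, T ρ ∈ Set.Icc (0 : ℝ) 1) {f : Kernel (X × A) Y} (hf : f ∈ F)
    (hm : Measurable fun p => T (f p)) : Integrable (fun x => avg T f x (κ x)) Q := by
  simp_rw [avg_eq_sum]
  refine integrable_sum_kernel_real κ hm (B := 1) fun p => ?_
  have := hT _ (mem_members hf p)
  rw [abs_of_nonneg this.1]
  exact this.2

variable {pol : (n : ℕ) → Kernel (Hist X A Y Z n × X) A} [∀ n, IsMarkovKernel (pol n)]

theorem integrable_sum_policy [IsProbabilityMeasure P.Q] {n : ℕ} (h : Hist X A Y Z n)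
    {φ : X × A → ℝ} (hφ : Measurable φ) {B : ℝ} (hB : ∀ p, |φ p| ≤ B) :
    Integrable (fun x => ∑ a, (pol n (h, x)).real {a} * φ (x, a)) P.Q :=
  integrable_sum_kernel_real ((pol n).comap (fun x => (h, x)) measurable_prodMk_left) hφ hB

theorem integral_roundKernel [IsProbabilityMeasure P.Q] {n : ℕ} (h : Hist X A Y Z n)
    {φ : X × A → ℝ} (hφ : Measurable φ) {B : ℝ} (hB : ∀ p, |φ p| ≤ B) :
    ∫ p, φ p ∂(P.roundKernel pol n h)
      = ∫ x, ∑ a, (pol n (h, x)).real {a} * φ (x, a) ∂P.Q := by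
  unfold Problem.roundKernel
  rw [integral_compProd (Integrable.of_bound hφ.aestronglyMeasurable B
    (Filter.Eventually.of_forall hB))]
  simp only [Kernel.const_apply]
  refine integral_congr_ae (Filter.Eventually.of_forall fun x => ?_)
  simp only
  rw [integral_fintype Integrable.of_finite]
  simp

theorem Problem.Valid.integrable_residual (hV : P.Valid L CD) {n : ℕ} (h : Hist X A Y Z n) :
    Integrable (P.residual L δ pol h) P.Q := by
  have := hV.prob_Q
  have heq := funext fun x => P.residual_eq (L := L) (δ := δ) pol h x
  rw [show P.residual L δ pol h = _ from heq]
  refine Integrable.div_const (integrable_finsetSum _ fun j _ => ?_) _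
  exact integrable_sum_policy _ (hV.measurable_sq_sub (hV.fhat_mem h))
    (hV.abs_sq_sub_le (hV.fhat_mem h))

/-- The residual applies the earlier policies to a new context. As every context is a fresh draw
from `Q`, integrating over it restores the conditional laws of the earlier rounds. -/
theorem Problem.Valid.integral_residual (hV : P.Valid L CD) {n : ℕ} (h : Hist X A Y Z n) :
    ∫ x, P.residual L δ pol h x ∂P.Q
      = (∑ j : Fin n, ∫ p, (P.T₁ (P.fhat h p) - P.T₁ (P.fstar p)) ^ 2
          ∂(P.roundKernel pol j (h.take j))) / (4 * P.beta L δ (n + 1)) := by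
  have := hV.prob_Q
  have hm := hV.measurable_sq_sub (hV.fhat_mem h)
  have hb := hV.abs_sq_sub_le (hV.fhat_mem h)
  simp_rw [Problem.residual_eq]
  rw [integral_div, integral_finsetSum _ fun j _ => integrable_sum_policy _ hm hb]
  simp_rw [integral_roundKernel _ hm hb]

end Integrals

/-- Telescoping of `1/(t³ - t)`. The round `t = 1` is left out, as it always belongs to the warm-up;
this brings the sum down to `1/4`. -/
theorem sum_inv_cube_le (N : ℕ) :
    ∑ n ∈ Finset.range (N + 1), (if 1 ≤ n then 1 / ((n : ℝ) + 1) ^ 3 else (0 : ℝ))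
      ≤ 1 / 4 - 1 / (2 * ((N : ℝ) + 1) * (N + 2)) := by
  induction N with
  | zero => norm_num
  | succ N ih =>
    rw [Finset.sum_range_succ, if_pos (by omega)]
    refine (add_le_add_left ih _).trans ?_
    push_cast
    have h1 : 1 / (((N : ℝ) + 1) + 1) ^ 3 ≤ 1 / (((N : ℝ) + 1) * (N + 2) * (N + 3)) := by
      refine one_div_le_one_div_of_le (by positivity) ?_
      have : (0 : ℝ) ≤ N := Nat.cast_nonneg N
      nlinarith
    have h2 : 1 / (((N : ℝ) + 1) * (N + 2) * (N + 3))
        = 1 / (2 * ((N : ℝ) + 1) * (N + 2)) - 1 / (2 * ((N : ℝ) + 1 + 1) * (N + 1 + 2)) := by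
      field_simp
      ring
    linarith

/-! ### Size of `β_t` and short horizons -/

section Beta

variable {X A Y Z : Type*} [MeasurableSpace X] [MeasurableSpace A] [MeasurableSpace Y]
  [MeasurableSpace Z] {P : Problem X A Y Z} {L CD δ : ℝ}

theorem Problem.log_two_le (hF : P.F.Nonempty) (h0 : 0 < δ) (h1 : δ < 1) {t : ℕ} (ht : 1 ≤ t) :
    Real.log 2 ≤ Real.log (2 * (P.F.card : ℝ) * (t : ℝ) ^ 3 / δ) := by
  have hc : (1 : ℝ) ≤ P.F.card := by exact_mod_cast hF.card_pos
  have ht' : (1 : ℝ) ≤ (t : ℝ) ^ 3 := one_le_pow₀ (by exact_mod_cast ht)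
  refine Real.log_le_log (by norm_num) ?_
  rw [le_div_iff₀ h0]
  nlinarith [mul_nonneg (sub_nonneg.2 hc) (sub_nonneg.2 ht')]

theorem Problem.Valid.rate_remainder_nonneg (hV : P.Valid L CD) (x : X) (h0 : 0 < δ) (h1 : δ < 1)
    (T : ℕ) (d : ℝ) (hd : 0 ≤ d) :
    0 ≤ 1 / (T : ℝ) + P.C * (1 + Real.log (1 / δ)) * min (T : ℝ) d
      + 4 * Real.sqrt (d * P.radG δ T * T) := by
  have hC := hV.C_nonneg x
  have hl : 0 ≤ Real.log (1 / δ) := Real.log_nonneg ((one_le_div h0).2 h1.le)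
  have : 0 ≤ min (T : ℝ) d := le_min (Nat.cast_nonneg T) hd
  positivity

variable [Fintype A]

theorem Problem.beta_sq (hF : P.F.Nonempty) (h0 : 0 < δ) (h1 : δ < 1) {t : ℕ} (ht : 1 ≤ t)
    (hrad : 0 ≤ P.radF δ t) :
    P.beta L δ t ^ 2 = (34 * Real.log (2 * (P.F.card : ℝ) * (t : ℝ) ^ 3 / δ)
      + 2 * L ^ 2 * P.radF δ t) * (t : ℝ) / (Fintype.card A : ℝ) := by
  have h2 := P.log_two_le hF h0 h1 ht
  have h3 := Real.log_two_gt_d9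
  have h4 : 0 ≤ Real.log (2 * (P.F.card : ℝ) * (t : ℝ) ^ 3 / δ) := by linarith
  exact Real.sq_sqrt (by positivity)

/-- The logarithm is at least `log 2` and `34 log 2 ≥ 1`. Hence `β_T ≥ 1` as soon as `T ≥ K`. -/
theorem Problem.sqrt_div_le_beta (hF : P.F.Nonempty) (h0 : 0 < δ) (h1 : δ < 1) {t : ℕ}
    (ht : 1 ≤ t) (hrad : 0 ≤ P.radF δ t) :
    Real.sqrt ((t : ℝ) / Fintype.card A) ≤ P.beta L δ t := by
  have h2 := P.log_two_le hF h0 h1 ht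
  have h3 := Real.log_two_gt_d9
  refine Real.sqrt_le_sqrt ?_
  have h5 : 0 ≤ 2 * L ^ 2 * P.radF δ t := by positivity
  gcongr
  exact le_mul_of_one_le_left (Nat.cast_nonneg t) (by linarith)

theorem Problem.beta_pos [Nonempty A] (hF : P.F.Nonempty) (h0 : 0 < δ) (h1 : δ < 1) {t : ℕ}
    (ht : 1 ≤ t) (hrad : 0 ≤ P.radF δ t) : 0 < P.beta L δ t := by
  have hK : (0 : ℝ) < Fintype.card A := by exact_mod_cast Fintype.card_pos
  have ht' : (0 : ℝ) < t := by exact_mod_cast ht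
  exact (Real.sqrt_pos.2 (div_pos ht' hK)).trans_le (P.sqrt_div_le_beta hF h0 h1 ht hrad)

theorem Problem.beta_le_beta (hF : P.F.Nonempty) (h0 : 0 < δ) (h1 : δ < 1) {s t : ℕ}
    (hs : 1 ≤ s) (hst : s ≤ t) (hrad : 0 ≤ P.radF δ s) (hle : P.radF δ s ≤ P.radF δ t) :
    P.beta L δ s ≤ P.beta L δ t := by
  have h2 := P.log_two_le hF h0 h1 (hs.trans hst)
  have h3 := Real.log_two_gt_d9
  have hc : (0 : ℝ) < P.F.card := by exact_mod_cast hF.card_pos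
  have hs' : (0 : ℝ) < s := by exact_mod_cast hs
  have h4 : 0 ≤ Real.log (2 * (P.F.card : ℝ) * (t : ℝ) ^ 3 / δ) := by linarith
  have h5 : 0 ≤ P.radF δ t := hrad.trans hle
  refine Real.sqrt_le_sqrt ?_
  gcongr

/-- Here `log (T/K)` may be negative, but it is at least `-K/2`, and `β_T ≥ √(T/K) ≥ T/K`; so the
first term of the rate is at least `2 (T/K)(K/2) = T`. -/
theorem Problem.Valid.natCast_le_rate (hV : P.Valid L CD) (x : X) (h0 : 0 < δ) (h1 : δ < 1)
    {T : ℕ} (hT : 1 ≤ T) (hTK : T ≤ Fintype.card A) (hrad : 0 ≤ P.radF δ T) :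
    (T : ℝ) ≤ P.rate L δ T := by
  have hT' : (1 : ℝ) ≤ T := by exact_mod_cast hT
  have hK' : (T : ℝ) ≤ Fintype.card A := by exact_mod_cast hTK
  have hβ := P.sqrt_div_le_beta (L := L) ⟨_, hV.fstar_mem⟩ h0 h1 hT hrad
  have hrem := mul_nonneg (hV.alpha_nonneg x) (hV.rate_remainder_nonneg x h0 h1 T
    (eluderDim P.G P.D₂ (1 / (T : ℝ) ^ 2)).toNat (Nat.cast_nonneg _))
  unfold Problem.rate
  simp only
  set K : ℝ := (Fintype.card A : ℝ)
  set β := P.beta L δ T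
  have hK0 : 0 < K := by linarith
  have hratio : (T : ℝ) / K ≤ β := by
    refine le_trans ?_ hβ
    refine Real.le_sqrt_of_sq_le ?_
    have h2 : (T : ℝ) / K ≤ 1 := (div_le_one hK0).2 hK'
    have h3 : 0 ≤ (T : ℝ) / K := by positivity
    nlinarith
  have hβ0 : 0 ≤ β := Real.sqrt_nonneg _
  have hlog : -(K / 2) ≤ Real.log (T / K) := by
    -- `log u ≥ 1 - 1/u` at `u = 2T/K`; the doubling halves `K/T`, and its cost `log 2` is less than
    -- `1`.
    have h2 := Real.one_sub_inv_le_log_of_pos (show 0 < (2 : ℝ) * (T / K) by positivity)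
    rw [Real.log_mul (by norm_num) (by positivity)] at h2
    have h3 : ((2 : ℝ) * (T / K))⁻¹ ≤ K / 2 := by
      rw [mul_inv, inv_div, div_eq_mul_inv K 2, mul_comm]
      gcongr
      exact div_le_self hK0.le hT'
    have h4 := Real.log_two_lt_d9
    linarith
  have h5 : (T : ℝ) ≤ 2 * β * (K + Real.log (T / K)) := by
    calc (T : ℝ) = 2 * (T / K) * (K / 2) := by field_simp
      _ ≤ 2 * β * (K + Real.log (T / K)) := by
        gcongr
        linarith
  have h6 : 0 ≤ 2 * K * β * Real.log T := by
    have := Real.log_nonneg hT'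
    positivity
  linarith

end Beta

/-! ### Summing the regret on the good event -/

section Regret

variable {X A Y Z Ω : Type*} [MeasurableSpace X] [Fintype A] [MeasurableSpace A]
  [MeasurableSpace Y] [MeasurableSpace Z] {P : Problem X A Y Z} {L CD δ : ℝ}
  {pol : (n : ℕ) → Kernel (Hist X A Y Z n × X) A} [∀ n, IsMarkovKernel (pol n)]
  {W : ℕ → Ω → X × A × Y × Z}

/-- For `d ≥ 1` the concentration error `C log (2/δ)` is absorbed by `C (1 + log (1/δ)) min {T, d}`.
For `d = 0` every diameter is at most `1/T²` and no concentration is used. -/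
theorem Problem.Valid.sum_integral_confDiam_le (hV : P.Valid L CD)
    (hG : P.G.Nonempty) (h0 : 0 < δ) (h1 : δ < 1) {T : ℕ} (hT : 1 ≤ T)
    (hradG : 0 ≤ P.radG δ T) (hmonoG : MonotoneOn (P.radG δ) (Set.Icc 1 T)) (ω : Ω)
    (hdiam : ∑ n ∈ Finset.range T with Fintype.card A ≤ n,
        ∫ p, P.confDiam hG δ (hist W n ω, p) ∂(P.roundKernel pol n (hist W n ω))
      ≤ 2 * (∑ n ∈ Finset.range T with Fintype.card A ≤ n,
          P.confDiam hG δ (hist W n ω, ((W n ω).1, (W n ω).2.1)) + P.C * Real.log (1 / (δ / 2)))) :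
    ∑ n ∈ Finset.range T with Fintype.card A ≤ n,
        ∫ p, P.confDiam hG δ (hist W n ω, p) ∂(P.roundKernel pol n (hist W n ω))
      ≤ (4 + 2 * |CD|) * (1 / (T : ℝ) + P.C * (1 + Real.log (1 / δ))
        * min (T : ℝ) ((eluderDim P.G P.D₂ (1 / (T : ℝ) ^ 2)).toNat : ℝ)
      + 4 * Real.sqrt (((eluderDim P.G P.D₂ (1 / (T : ℝ) ^ 2)).toNat : ℝ) * P.radG δ T * T)) := by
  have := hV.prob_Q
  have x₀ := (W 0 ω).1
  have hC := hV.C_nonneg x₀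
  have hT' : (1 : ℝ) ≤ T := by exact_mod_cast hT
  have hdm : ∀ n, Measurable fun p => P.confDiam hG δ (hist W n ω, p) := fun n =>
    (hV.measurable_confDiam hG n).comp measurable_prodMk_left
  have hdb : ∀ n p, |P.confDiam hG δ (hist W n ω, p)| ≤ P.C := fun n p => by
    rw [abs_of_nonneg (hV.confDiam_nonneg hG _)]
    exact hV.confDiam_le hG _
  set S := (Finset.range T).filter fun n => Fintype.card A ≤ n
  have hrem := hV.rate_remainder_nonneg x₀ h0 h1 T
    (eluderDim P.G P.D₂ (1 / (T : ℝ) ^ 2)).toNat (Nat.cast_nonneg _)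
  have hCD : 0 ≤ |CD| := abs_nonneg CD
  have hlog : 0 ≤ Real.log (1 / δ) := Real.log_nonneg ((one_le_div h0).2 h1.le)
  have hTi : 0 ≤ 1 / (T : ℝ) := by positivity
  rcases Nat.eq_zero_or_pos (eluderDim P.G P.D₂ (1 / (T : ℝ) ^ 2)).toNat with hd | hd
  · have hle : ∀ n ∈ S, ∫ p, P.confDiam hG δ (hist W n ω, p)
        ∂(P.roundKernel pol n (hist W n ω)) ≤ 1 / (T : ℝ) ^ 2 := fun n _ => by
      refine (integral_mono (Integrable.of_bound (hdm n).aestronglyMeasurable P.C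
        (Filter.Eventually.of_forall (hdb n))) (integrable_const (1 / (T : ℝ) ^ 2))
        fun p => P.confDiam_le_of_eluderDim_eq_zero hG (by positivity) hd _).trans ?_
      simp
    have hcard : (S.card : ℝ) ≤ T := by
      exact_mod_cast (Finset.card_filter_le _ _).trans (Finset.card_range T).le
    have h2 : ∑ n ∈ S, ∫ p, P.confDiam hG δ (hist W n ω, p)
        ∂(P.roundKernel pol n (hist W n ω)) ≤ 1 / (T : ℝ) := by
      refine (Finset.sum_le_sum hle).trans ?_
      rw [Finset.sum_const, nsmul_eq_mul]
      calc (S.card : ℝ) * (1 / (T : ℝ) ^ 2) ≤ T * (1 / (T : ℝ) ^ 2) := by gcongr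
        _ = 1 / (T : ℝ) := by field_simp
    refine h2.trans ?_
    rw [hd]
    simp only [Nat.cast_zero, zero_mul, Real.sqrt_zero, mul_zero, add_zero,
      min_eq_right (Nat.cast_nonneg T : (0 : ℝ) ≤ T)]
    nlinarith
  · have h2 := hV.sum_confDiam_le hG hT hmonoG hradG W ω S (Finset.filter_subset _ _)
    set d : ℝ := ((eluderDim P.G P.D₂ (1 / (T : ℝ) ^ 2)).toNat : ℝ)
    have hd1 : 1 ≤ min (T : ℝ) d := le_min hT' (Nat.one_le_cast.2 hd)
    have hl2 : Real.log (1 / (δ / 2)) ≤ 1 + Real.log (1 / δ) := by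
      rw [show 1 / (δ / 2) = 2 * (1 / δ) by field_simp, Real.log_mul (by norm_num)
        (by positivity)]
      linarith [Real.log_two_lt_d9]
    set m := min (T : ℝ) d
    set l := Real.log (1 / δ)
    set s := Real.sqrt (d * P.radG δ T * T)
    have hs : 0 ≤ s := Real.sqrt_nonneg _
    have h3 : P.C * Real.log (1 / (δ / 2)) ≤ P.C * (1 + l) * m := by
      refine (mul_le_mul_of_nonneg_left hl2 hC).trans ?_
      exact le_mul_of_one_le_right (by positivity) hd1
    have h4 : P.C * m ≤ P.C * (1 + l) * m := by
      gcongr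
      exact le_mul_of_one_le_right hC (by linarith)
    have h5 : 0 ≤ P.C * (1 + l) * m := by positivity
    have h6 : 0 ≤ |CD| * (1 / (T : ℝ) + P.C * (1 + l) * m) := by positivity
    have h7 : 0 ≤ |CD| * s := by positivity
    linarith

variable [DiscreteMeasurableSpace A]

theorem Problem.Valid.integrable_avg_policy (hV : P.Valid L CD) {n : ℕ} (h : Hist X A Y Z n) :
    Integrable (fun x => avg P.T₁ P.fstar x (pol n (h, x))) P.Q := by
  have := hV.prob_Q
  exact integrable_avg ((pol n).comap (fun x => (h, x)) measurable_prodMk_left) hV.T₁_mem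
    hV.fstar_mem (hV.meas_T₁ _ hV.fstar_mem)

theorem Problem.Valid.regret_eq_integral (hV : P.Valid L CD) (T : ℕ) (πs : Kernel X A)
    [IsMarkovKernel πs] (ω : Ω) :
    P.regret pol W T πs ω = ∫ x, ∑ n ∈ Finset.range T, (avg P.T₁ P.fstar x (πs x)
      - avg P.T₁ P.fstar x (pol n (hist W n ω, x))) ∂P.Q := by
  have := hV.prob_Q
  have h1 : Integrable (fun x => avg P.T₁ P.fstar x (πs x)) P.Q :=
    integrable_avg πs hV.T₁_mem hV.fstar_mem (hV.meas_T₁ _ hV.fstar_mem)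
  have h2 : ∀ n ∈ Finset.range T, Integrable (fun x => avg P.T₁ P.fstar x (πs x)
      - avg P.T₁ P.fstar x (pol n (hist W n ω, x))) P.Q := fun n _ =>
    h1.sub (hV.integrable_avg_policy (hist W n ω))
  rw [integral_finsetSum _ h2, Problem.regret, ← Finset.sum_sub_distrib]
  exact Finset.sum_congr rfl fun n _ =>
    (integral_sub h1 (hV.integrable_avg_policy (hist W n ω))).symm

theorem Problem.Valid.integrable_sum_avg_sub (hV : P.Valid L CD) (T : ℕ) (πs : Kernel X A)
    [IsMarkovKernel πs] (ω : Ω) :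
    Integrable (fun x => ∑ n ∈ Finset.range T, (avg P.T₁ P.fstar x (πs x)
      - avg P.T₁ P.fstar x (pol n (hist W n ω, x)))) P.Q := by
  have := hV.prob_Q
  exact integrable_finsetSum _ fun n _ =>
    (integrable_avg πs hV.T₁_mem hV.fstar_mem (hV.meas_T₁ _ hV.fstar_mem)).sub
      (hV.integrable_avg_policy (hist W n ω))

theorem Problem.Valid.avg_sub_le_one (hV : P.Valid L CD) (x : X) (π π' : Measure A)
    [IsProbabilityMeasure π] [IsProbabilityMeasure π'] :
    avg P.T₁ P.fstar x π - avg P.T₁ P.fstar x π' ≤ 1 := by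
  have h1 := avg_mem_Icc hV.T₁_mem hV.fstar_mem x π
  have h2 := avg_mem_Icc hV.T₁_mem hV.fstar_mem x π'
  linarith [h1.2, h2.1]

theorem Problem.Valid.regret_le_natCast (hV : P.Valid L CD) (T : ℕ) (πs : Kernel X A)
    [IsMarkovKernel πs] (ω : Ω) : P.regret pol W T πs ω ≤ T := by
  have := hV.prob_Q
  rw [hV.regret_eq_integral]
  refine (integral_mono (hV.integrable_sum_avg_sub T πs ω) (integrable_const (T : ℝ))
    fun x => ?_).trans (by simp)
  refine (Finset.sum_le_sum fun n _ => hV.avg_sub_le_one x (πs x) _).trans ?_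
  simp

/-- `β_t` is tuned so that the mean squared errors sum to at most `β_t² K/t`; dividing by `4 β_t`
leaves `β_t K/(4t)`, which is summable to a logarithm. -/
theorem Problem.Valid.integral_residual_le (hV : P.Valid L CD) (h0 : 0 < δ) (h1 : δ < 1) {n : ℕ}
    (hrad : 0 ≤ P.radF δ (n + 1)) (h : Hist X A Y Z n)
    (hres : ∑ j : Fin n, ∫ p, (P.T₁ (P.fhat h p) - P.T₁ (P.fstar p)) ^ 2
          ∂(P.roundKernel pol j (h.take j))
        ≤ 2 * (L ^ 2 * P.radF δ (n + 1)
          + Real.log (2 * (P.F.card : ℝ) * ((n + 1 : ℕ) : ℝ) ^ 3 / δ))) :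
    ∫ x, P.residual L δ pol h x ∂P.Q
      ≤ P.beta L δ (n + 1) * Fintype.card A / 4 * ((n + 1 : ℕ) : ℝ)⁻¹ := by
  have : Nonempty A := ⟨P.a₀⟩
  have hF : P.F.Nonempty := ⟨_, hV.fstar_mem⟩
  have hK1 : (1 : ℝ) ≤ Fintype.card A := by exact_mod_cast Fintype.card_pos
  have hb := P.beta_pos (L := L) hF h0 h1 (t := n + 1) (by omega) hrad
  rw [hV.integral_residual]
  have h3 := P.beta_sq (L := L) hF h0 h1 (t := n + 1) (by omega) (hrad)
  have h4 := P.log_two_le hF h0 h1 (t := n + 1) (by omega)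
  have h5 := Real.log_two_gt_d9
  have hn0 : (0 : ℝ) < ((n + 1 : ℕ) : ℝ) := by positivity
  set M := ∑ j : Fin n, ∫ p, (P.T₁ (P.fhat (h) p) - P.T₁ (P.fstar p)) ^ 2
      ∂(P.roundKernel pol j (h.take j)) with hM
  have h6 : M ≤ P.beta L δ (n + 1) ^ 2 * Fintype.card A / ((n + 1 : ℕ) : ℝ) := by
    rw [h3]
    refine hres.trans ?_
    rw [div_mul_cancel₀ _ (by linarith : (Fintype.card A : ℝ) ≠ 0),
      mul_div_cancel_right₀ _ hn0.ne']
    linarith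
  have h7 : M / (4 * P.beta L δ (n + 1))
      ≤ P.beta L δ (n + 1) * Fintype.card A / 4 * ((n + 1 : ℕ) : ℝ)⁻¹ := by
    rw [div_le_iff₀ (by positivity)]
    refine h6.trans (le_of_eq ?_)
    field_simp
  exact h7

/-- Warm-up, bonuses and residuals are each multiples of `βK(1 + l)`, with coefficients `1`, `2` and
`1/2`; the `2` in the constant provides `4`. -/
theorem le_rate_of_components {r K β l l' α R V s a b : ℝ} (hβ : 1 ≤ β) (hK : 1 ≤ K) (hl : 0 ≤ l)
    (hl' : 0 ≤ l') (hα : 0 ≤ α) (hR : 0 ≤ R) (ha : 0 ≤ a) (hb : 0 ≤ b)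
    (hr : r ≤ (K + 2 * β * (K * (1 + l))) + (α * a * V + 2 * s)) (hV : V ≤ (4 + 2 * b) * R)
    (hs : 2 * s ≤ β * K / 2 * (1 + l)) :
    r ≤ (2 + a * (4 + 2 * b)) * (2 * β * (K + l') + 2 * K * β * l + α * R) := by
  have hw := mul_le_mul_of_nonneg_left hV (by positivity : 0 ≤ α * a)
  have hβK : K ≤ β * K * (1 + l) := by
    have h2 : K ≤ β * K := le_mul_of_one_le_left (by linarith) hβ
    exact h2.trans (le_mul_of_one_le_right (by positivity) (by linarith))
  have hβKl : 0 ≤ β * K * (1 + l) := by positivity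
  have hmain : β * K * (1 + l) ≤ β * (K + l') + K * β * l := by
    have : 0 ≤ β * l' := by positivity
    linarith
  have hαR : 0 ≤ α * R := mul_nonneg hα hR
  have hcm := mul_nonneg (by positivity : 0 ≤ a * (4 + 2 * b)) (hβKl.trans hmain)
  linarith

/-- The regret bound on the event on which the confidence sets are valid and the conditional means
concentrate. -/
theorem Problem.IsGEDUCB.regret_le (hpol : P.IsGEDUCB L δ pol) (hV : P.Valid L CD)
    (hG : P.G.Nonempty) (h0 : 0 < δ) (h1 : δ < 1) {T : ℕ} (hT : 1 ≤ T)
    (hKT : Fintype.card A < T) (hradF : ∀ n, 0 ≤ P.radF δ (n + 1)) (hradG : 0 ≤ P.radG δ T)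
    (hmonoF : MonotoneOn (P.radF δ) (Set.Icc 1 T)) (hmonoG : MonotoneOn (P.radG δ) (Set.Icc 1 T))
    (ω : Ω)
    (hconf : ∀ n, Fintype.card A ≤ n → n < T → P.gstar ∈ P.confSet δ (hist W n ω))
    (hres : ∀ n, Fintype.card A ≤ n → n < T →
      ∑ j : Fin n, ∫ p, (P.T₁ (P.fhat (hist W n ω) p) - P.T₁ (P.fstar p)) ^ 2
          ∂(P.roundKernel pol j (hist W j ω))
        ≤ 2 * (L ^ 2 * P.radF δ (n + 1)
          + Real.log (2 * (P.F.card : ℝ) * ((n + 1 : ℕ) : ℝ) ^ 3 / δ)))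
    (hdiam : ∑ n ∈ Finset.range T with Fintype.card A ≤ n,
        ∫ p, P.confDiam hG δ (hist W n ω, p) ∂(P.roundKernel pol n (hist W n ω))
      ≤ 2 * (∑ n ∈ Finset.range T with Fintype.card A ≤ n,
          P.confDiam hG δ (hist W n ω, ((W n ω).1, (W n ω).2.1)) + P.C * Real.log (1 / (δ / 2))))
    (πs : Kernel X A) [IsMarkovKernel πs] (hπs : P.IsFeasiblePolicy πs) :
    P.regret pol W T πs ω ≤ (2 + |L| * (4 + 2 * |CD|)) * P.rate L δ T := by
  have := hV.prob_Q
  have hF : P.F.Nonempty := ⟨_, hV.fstar_mem⟩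
  have x₀ := (W 0 ω).1
  have : Nonempty A := ⟨P.a₀⟩
  have hα := hV.alpha_nonneg x₀
  have hC := hV.C_nonneg x₀
  have hT' : (1 : ℝ) ≤ T := by exact_mod_cast hT
  have hK1 : (1 : ℝ) ≤ Fintype.card A := by exact_mod_cast Fintype.card_pos
  have hKT' : (Fintype.card A : ℝ) ≤ T := by exact_mod_cast hKT.le
  have hradFT : 0 ≤ P.radF δ T := by
    have := hradF (T - 1)
    rwa [Nat.sub_add_cancel hT] at this
  have hβ1 : 1 ≤ P.beta L δ T := by
    refine le_trans ?_ (P.sqrt_div_le_beta hF h0 h1 hT hradFT)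
    rw [Real.one_le_sqrt, one_le_div (by linarith)]
    exact hKT'
  set S := (Finset.range T).filter fun n => Fintype.card A ≤ n with hS
  have hmemS : ∀ n ∈ S, n < T ∧ Fintype.card A ≤ n := fun n hn => by simpa [hS] using hn
  have hβn : ∀ n ∈ S, P.beta L δ (n + 1) ≤ P.beta L δ T := fun n hn => by
    have := hmemS n hn
    refine P.beta_le_beta hF h0 h1 (by omega) (by omega) (hradF n) ?_
    exact hmonoF ⟨by omega, by omega⟩ ⟨hT, le_rfl⟩ (by omega)
  have hβpos : ∀ n, 0 < P.beta L δ (n + 1) := fun n =>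
    P.beta_pos hF h0 h1 (by omega) (hradF n)
  let V : ℕ → X → ℝ := fun n x =>
    ∑ a, (pol n (hist W n ω, x)).real {a} * P.confDiam hG δ (hist W n ω, (x, a))
  have hdm : ∀ n, Measurable fun p => P.confDiam hG δ (hist W n ω, p) := fun n =>
    (hV.measurable_confDiam hG n).comp measurable_prodMk_left
  have hdb : ∀ n p, |P.confDiam hG δ (hist W n ω, p)| ≤ P.C := fun n p => by
    rw [abs_of_nonneg (hV.confDiam_nonneg hG _)]
    exact hV.confDiam_le hG _
  have hVint : ∀ n, Integrable (V n) P.Q := fun n => integrable_sum_policy _ (hdm n) (hdb n)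
  have hRint : ∀ n, Integrable (P.residual L δ pol (hist W n ω)) P.Q := fun n =>
    hV.integrable_residual _
  have hVval : ∀ n, ∫ x, V n x ∂P.Q
      = ∫ p, P.confDiam hG δ (hist W n ω, p) ∂(P.roundKernel pol n (hist W n ω)) := fun n =>
    (integral_roundKernel _ (hdm n) (hdb n)).symm
  -- The sum over rounds is bounded before integrating, because the bonuses telescope only at a
  -- fixed context.
  have hpt : ∀ x, ∑ n ∈ Finset.range T, (avg P.T₁ P.fstar x (πs x)
      - avg P.T₁ P.fstar x (pol n (hist W n ω, x)))
      ≤ (Fintype.card A + 2 * P.beta L δ T * (Fintype.card A * (1 + Real.log T)))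
        + ∑ n ∈ S, (P.alpha * |L| * V n x + 2 * P.residual L δ pol (hist W n ω) x) := by
    intro x
    rw [← Finset.sum_filter_add_sum_filter_not (Finset.range T) (fun n => Fintype.card A ≤ n),
      ← hS]
    have hwarm : ∑ n ∈ Finset.range T with ¬ Fintype.card A ≤ n, (avg P.T₁ P.fstar x (πs x)
        - avg P.T₁ P.fstar x (pol n (hist W n ω, x))) ≤ Fintype.card A := by
      refine (Finset.sum_le_sum fun n _ => hV.avg_sub_le_one x (πs x) _).trans ?_
      rw [Finset.sum_const, nsmul_eq_mul, mul_one]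
      have hsub : (Finset.range T).filter (fun n => ¬ Fintype.card A ≤ n)
          ⊆ Finset.range (Fintype.card A) := fun n hn =>
        Finset.mem_range.2 (not_le.1 (Finset.mem_filter.1 hn).2)
      exact_mod_cast (Finset.card_le_card hsub).trans (Finset.card_range _).le
    have hbon := sum_bonus_le (fun n => pol n (hist W n ω, x)) T
    rw [← Finset.sum_filter, ← hS] at hbon
    have hround : ∑ n ∈ S, (avg P.T₁ P.fstar x (πs x)
        - avg P.T₁ P.fstar x (pol n (hist W n ω, x)))
        ≤ ∑ n ∈ S, (2 * P.beta L δ T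
          * bonus (fun j : Fin n => pol j (hist W j ω, x)) (pol n (hist W n ω, x))
          + (P.alpha * |L| * V n x + 2 * P.residual L δ pol (hist W n ω) x)) := by
      refine Finset.sum_le_sum fun n hn => ?_
      obtain ⟨hnT, hnK⟩ := hmemS n hn
      have hg := hconf n hnK hnT
      have h2 := hpol.avg_sub_avg_le hV hnK (hβpos n) hg x (πs x) (hπs x)
      have h3 := mul_le_mul_of_nonneg_left (hV.width_le hG hg x (pol n (hist W n ω, x))) hα
      have h4 := mul_le_mul_of_nonneg_right (hβn n hn)
        (bonus_nonneg (fun j : Fin n => pol j (hist W j ω, x)) (pol n (hist W n ω, x)))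
      have h5 : P.alpha * (|L| * ∑ a, (pol n (hist W n ω, x)).real {a}
          * P.confDiam hG δ (hist W n ω, (x, a))) = P.alpha * |L| * V n x := by
        rw [mul_assoc]
      rw [h5] at h3
      have h6 : (fun j : Fin n => pol j ((hist W n ω).take j, x))
          = fun j : Fin n => pol j (hist W j ω, x) := rfl
      rw [h6] at h2
      linarith
    rw [Finset.sum_add_distrib, ← Finset.mul_sum] at hround
    have h7 := mul_le_mul_of_nonneg_left hbon (by linarith : 0 ≤ 2 * P.beta L δ T)
    linarith
  have hint : P.regret pol W T πs ω
      ≤ (Fintype.card A + 2 * P.beta L δ T * (Fintype.card A * (1 + Real.log T)))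
        + (P.alpha * |L| * ∑ n ∈ S, ∫ x, V n x ∂P.Q
          + 2 * ∑ n ∈ S, ∫ x, P.residual L δ pol (hist W n ω) x ∂P.Q) := by
    have hi : ∀ n ∈ S, Integrable (fun x => P.alpha * |L| * V n x
        + 2 * P.residual L δ pol (hist W n ω) x) P.Q := fun n _ =>
      ((hVint n).const_mul _).add ((hRint n).const_mul _)
    rw [hV.regret_eq_integral]
    refine (integral_mono (hV.integrable_sum_avg_sub T πs ω)
      ((integrable_const _).add (integrable_finsetSum _ hi)) hpt).trans (le_of_eq ?_)
    rw [integral_add' (integrable_const _) (integrable_finsetSum _ hi), integral_finsetSum _ hi]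
    simp only [integral_const, probReal_univ, one_smul]
    rw [Finset.sum_congr rfl fun n _ =>
      integral_add ((hVint n).const_mul (P.alpha * |L|)) ((hRint n).const_mul 2)]
    simp_rw [integral_const_mul]
    rw [Finset.sum_add_distrib, Finset.mul_sum, Finset.mul_sum]
  have hlogT : 0 ≤ Real.log T := Real.log_nonneg hT'
  have hresid : 2 * ∑ n ∈ S, ∫ x, P.residual L δ pol (hist W n ω) x ∂P.Q
      ≤ P.beta L δ T * Fintype.card A / 2 * (1 + Real.log T) := by
    have hone : ∀ n ∈ S, ∫ x, P.residual L δ pol (hist W n ω) x ∂P.Q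
        ≤ P.beta L δ T * Fintype.card A / 4 * ((n + 1 : ℕ) : ℝ)⁻¹ := by
      intro n hn
      obtain ⟨hnT, hnK⟩ := hmemS n hn
      refine (hV.integral_residual_le h0 h1 (hradF n) (hist W n ω) (hres n hnK hnT)).trans ?_
      have := hβn n hn
      gcongr
    have hharm : ∑ n ∈ S, ((n + 1 : ℕ) : ℝ)⁻¹ ≤ 1 + Real.log T := by
      refine le_trans ?_ (harmonic_le_one_add_log T)
      rw [harmonic]
      push_cast
      exact Finset.sum_le_sum_of_subset_of_nonneg (Finset.filter_subset _ _)
        fun n _ _ => by positivity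
    have h8 := Finset.sum_le_sum hone
    rw [← Finset.mul_sum] at h8
    have h9 := mul_le_mul_of_nonneg_left hharm
      (by positivity : 0 ≤ P.beta L δ T * Fintype.card A / 4)
    linarith
  have hwidth : ∑ n ∈ S, ∫ x, V n x ∂P.Q ≤ (4 + 2 * |CD|) * (1 / (T : ℝ)
      + P.C * (1 + Real.log (1 / δ))
        * min (T : ℝ) ((eluderDim P.G P.D₂ (1 / (T : ℝ) ^ 2)).toNat : ℝ)
      + 4 * Real.sqrt (((eluderDim P.G P.D₂ (1 / (T : ℝ) ^ 2)).toNat : ℝ) * P.radG δ T * T)) := by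
    simp_rw [hVval]
    exact hV.sum_integral_confDiam_le hG h0 h1 hT hradG hmonoG ω hdiam
  have hrem := hV.rate_remainder_nonneg x₀ h0 h1 T
    (eluderDim P.G P.D₂ (1 / (T : ℝ) ^ 2)).toNat (Nat.cast_nonneg _)
  have hlogTK : 0 ≤ Real.log (T / Fintype.card A) :=
    Real.log_nonneg ((one_le_div (by linarith)).2 hKT')
  unfold Problem.rate
  exact le_rate_of_components hβ1 hK1 hlogT hlogTK hα hrem (abs_nonneg L) (abs_nonneg CD) hint
    hwidth hresid

end Regret

/-! ### The good event and its probability -/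

section GoodEvent

variable {X A Y Z Ω : Type*} [MeasurableSpace X] [MeasurableSpace A]
  [MeasurableSpace Y] [MeasurableSpace Z] [MeasurableSpace Ω]
  {P : Problem X A Y Z} {L CD δ : ℝ} {pol : (n : ℕ) → Kernel (Hist X A Y Z n × X) A}
  {μ : Measure Ω} [IsProbabilityMeasure μ] {W : ℕ → Ω → X × A × Y × Z}

theorem delta_div_pos (h0 : 0 < δ) (n : ℕ) : 0 < δ / (2 * ((n + 1 : ℕ) : ℝ) ^ 3) := by
  positivity

theorem delta_div_lt_one (h0 : 0 < δ) (h1 : δ < 1) (n : ℕ) :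
    δ / (2 * ((n + 1 : ℕ) : ℝ) ^ 3) < 1 := by
  have h2 : (1 : ℝ) ≤ ((n + 1 : ℕ) : ℝ) ^ 3 :=
    one_le_pow₀ (by exact_mod_cast Nat.succ_le_succ (Nat.zero_le n))
  rw [div_lt_one (by positivity)]
  linarith

theorem Problem.IsInteraction.radF_nonneg (hI : P.IsInteraction pol μ W) (hV : P.Valid L CD)
    (h0 : 0 < δ) (h1 : δ < 1) (n : ℕ) : 0 ≤ P.radF δ (n + 1) :=
  hI.estF_nonneg hV n (delta_div_pos h0 n) (delta_div_lt_one h0 h1 n)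

theorem Problem.IsInteraction.radG_nonneg (hI : P.IsInteraction pol μ W) (hV : P.Valid L CD)
    (h0 : 0 < δ) (h1 : δ < 1) (n : ℕ) : 0 ≤ P.radG δ (n + 1) :=
  hI.estG_nonneg hV n (delta_div_pos h0 n) (delta_div_lt_one h0 h1 n)

variable [∀ n, IsMarkovKernel (pol n)]

/-- With high probability the conditional means of the squared errors of all models of the utility
class are controlled by the empirical ones. -/
theorem Problem.IsInteraction.measure_exists_sum_integral_gt_le (hI : P.IsInteraction pol μ W)
    (hV : P.Valid L CD) (h0 : 0 < δ) (n : ℕ) :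
    μ (⋃ f ∈ P.F, {ω | 2 * (∑ j ∈ Finset.range n, (P.T₁ (f ((W j ω).1, (W j ω).2.1))
          - P.T₁ (P.fstar ((W j ω).1, (W j ω).2.1))) ^ 2
        + 1 * Real.log (1 / (δ / (2 * (P.F.card : ℝ) * ((n + 1 : ℕ) : ℝ) ^ 3))))
      < ∑ j ∈ Finset.range n, ∫ p, (P.T₁ (f p) - P.T₁ (P.fstar p)) ^ 2
          ∂(P.roundKernel pol j (hist W j ω))})
      ≤ ENNReal.ofReal (δ / (2 * ((n + 1 : ℕ) : ℝ) ^ 3)) := by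
  have := hV.prob_Q
  have hc : (0 : ℝ) < P.F.card := by
    exact_mod_cast Finset.card_pos.2 ⟨_, hV.fstar_mem⟩
  refine (measure_biUnion_finset_le _ _).trans ?_
  refine (Finset.sum_le_sum fun f hf =>
    hI.measure_sum_integral_gt_le
      (fun _ q => (P.T₁ (f q.2) - P.T₁ (P.fstar q.2)) ^ 2)
      (fun _ => (hV.measurable_sq_sub hf).comp measurable_snd) zero_le_one
      (fun _ _ => sq_nonneg _)
      (fun _ q => (le_abs_self _).trans (hV.abs_sq_sub_le hf q.2)) n
      -- Level of each model, so that the union over `F` costs `δ/(2t³)`.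
      (show 0 < δ / (2 * (P.F.card : ℝ) * ((n + 1 : ℕ) : ℝ) ^ 3) by positivity)).trans ?_
  rw [Finset.sum_const, nsmul_eq_mul, ← ENNReal.ofReal_natCast,
    ← ENNReal.ofReal_mul (Nat.cast_nonneg _)]
  refine ENNReal.ofReal_le_ofReal (le_of_eq ?_)
  field_simp

variable [Fintype A]

/-- The event on which the confidence sets are valid and the conditional means concentrate. -/
theorem Problem.IsInteraction.exists_good_event (hI : P.IsInteraction pol μ W)
    (hV : P.Valid L CD) (hG : P.G.Nonempty) (h0 : 0 < δ) (h1 : δ < 1) (T : ℕ) :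
    ∃ E : Set Ω, MeasurableSet E ∧ ENNReal.ofReal (1 - δ) ≤ μ E ∧ ∀ ω ∈ E,
      (∀ n, Fintype.card A ≤ n → n < T → P.gstar ∈ P.confSet δ (hist W n ω)) ∧
      (∀ n, Fintype.card A ≤ n → n < T →
        ∑ j : Fin n, ∫ p, (P.T₁ (P.fhat (hist W n ω) p) - P.T₁ (P.fstar p)) ^ 2
          ∂(P.roundKernel pol j (hist W j ω))
        ≤ 2 * (L ^ 2 * P.radF δ (n + 1)
          + Real.log (2 * (P.F.card : ℝ) * ((n + 1 : ℕ) : ℝ) ^ 3 / δ))) ∧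
      ∑ n ∈ Finset.range T with Fintype.card A ≤ n,
        ∫ p, P.confDiam hG δ (hist W n ω, p) ∂(P.roundKernel pol n (hist W n ω))
      ≤ 2 * (∑ n ∈ Finset.range T with Fintype.card A ≤ n,
        P.confDiam hG δ (hist W n ω, ((W n ω).1, (W n ω).2.1)) + P.C * Real.log (1 / (δ / 2))) := by
  have := hV.prob_Q
  have : Nonempty A := ⟨P.a₀⟩
  obtain ⟨ω₀⟩ : Nonempty Ω := nonempty_of_isProbabilityMeasure μ
  have hK := Fintype.card_pos (α := A)
  set S := (Finset.range T).filter fun n => Fintype.card A ≤ n with hS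
  let BF : ℕ → Set Ω := fun n => {ω | P.radF δ (n + 1) < ∑ i : Fin n,
    P.D₁ (P.fhat (hist W n ω) ((W i ω).1, (W i ω).2.1)) (P.fstar ((W i ω).1, (W i ω).2.1)) ^ 2}
  let BG : ℕ → Set Ω := fun n => {ω | P.radG δ (n + 1) < ∑ i : Fin n,
    P.D₂ (P.ghat (hist W n ω) ((W i ω).1, (W i ω).2.1)) (P.gstar ((W i ω).1, (W i ω).2.1)) ^ 2}
  let BC : ℕ → Set Ω := fun n =>
    ⋃ f ∈ P.F, {ω | 2 * (∑ j ∈ Finset.range n, (P.T₁ (f ((W j ω).1, (W j ω).2.1))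
          - P.T₁ (P.fstar ((W j ω).1, (W j ω).2.1))) ^ 2
        + 1 * Real.log (1 / (δ / (2 * (P.F.card : ℝ) * ((n + 1 : ℕ) : ℝ) ^ 3))))
      < ∑ j ∈ Finset.range n, ∫ p, (P.T₁ (f p) - P.T₁ (P.fstar p)) ^ 2
          ∂(P.roundKernel pol j (hist W j ω))}
  -- Diameters set to zero during the warm-up: concentration is stated for all rounds, and only
  -- later ones enter the regret.
  let φ : (n : ℕ) → Hist X A Y Z n × (X × A) → ℝ := fun n q =>
    if Fintype.card A ≤ n then P.confDiam hG δ q else 0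
  let BD : Set Ω := {ω | 2 * (∑ n ∈ Finset.range T, φ n (hist W n ω, ((W n ω).1, (W n ω).2.1))
        + P.C * Real.log (1 / (δ / 2)))
      < ∑ n ∈ Finset.range T, ∫ p, φ n (hist W n ω, p) ∂(P.roundKernel pol n (hist W n ω))}
  have hBD : μ BD ≤ ENNReal.ofReal (δ / 2) := by
    have hC := hV.C_nonneg (W 0 ω₀).1
    refine hI.measure_sum_integral_gt_le φ (fun n => ?_) hC (fun n q => ?_) (fun n q => ?_) T
      (half_pos h0)
    · by_cases hn : Fintype.card A ≤ n
      · simp only [φ, hn, if_true]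
        exact hV.measurable_confDiam hG n
      · simp only [φ, hn, if_false]
        exact measurable_const
    · by_cases hn : Fintype.card A ≤ n
      · simp only [φ, hn, if_true]
        exact hV.confDiam_nonneg hG q
      · simp [φ, hn]
    · by_cases hn : Fintype.card A ≤ n
      · simp only [φ, hn, if_true]
        exact hV.confDiam_le hG q
      · simpa only [φ, hn, if_false] using hC
  set Bad : Set Ω := (⋃ n ∈ S, (BF n ∪ BG n ∪ BC n)) ∪ BD with hBad
  have hround : ∀ n, μ (BF n ∪ BG n ∪ BC n)
      ≤ ENNReal.ofReal (3 / 2 * δ * (1 / ((n : ℝ) + 1) ^ 3)) := by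
    intro n
    have hp := delta_div_pos h0 n
    have hl := delta_div_lt_one h0 h1 n
    refine (measure_union_le _ _).trans ((add_le_add ((measure_union_le _ _).trans
      (add_le_add (hI.measure_radF_lt_le hV n hp hl) (hI.measure_radG_lt_le hV n hp hl)))
      (hI.measure_exists_sum_integral_gt_le hV h0 n)).trans ?_)
    rw [← ENNReal.ofReal_add hp.le hp.le, ← ENNReal.ofReal_add (by positivity) hp.le]
    refine ENNReal.ofReal_le_ofReal (le_of_eq ?_)
    push_cast
    field_simp
    ring
  have hμBad : μ Bad ≤ ENNReal.ofReal δ := by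
    -- Three failures at level `δ/(2t³)` per round total at most `3δ/8`; with `δ/2` for the
    -- diameters this stays below `δ`.
    have hsum : ∑ n ∈ S, 1 / ((n : ℝ) + 1) ^ 3 ≤ 1 / 4 := by
      have h2 := sum_inv_cube_le T
      rw [← Finset.sum_filter] at h2
      have h3 : (0 : ℝ) ≤ 1 / (2 * ((T : ℝ) + 1) * (T + 2)) := by positivity
      refine le_trans (Finset.sum_le_sum_of_subset_of_nonneg ?_ fun n _ _ => by positivity)
        (h2.trans (by linarith))
      intro n hn
      simp only [hS, Finset.mem_filter, Finset.mem_range] at hn ⊢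
      omega
    refine (measure_union_le _ _).trans ((add_le_add ((measure_biUnion_finset_le _ _).trans
      (Finset.sum_le_sum fun n _ => hround n)) hBD).trans ?_)
    rw [← ENNReal.ofReal_sum_of_nonneg fun n _ => by positivity,
      ← ENNReal.ofReal_add (Finset.sum_nonneg fun n _ => by positivity) (by positivity),
      ← Finset.mul_sum]
    refine ENNReal.ofReal_le_ofReal ?_
    nlinarith
  -- The bad set need not be measurable; its measurable hull has the same measure.
  refine ⟨(toMeasurable μ Bad)ᶜ, (measurableSet_toMeasurable _ _).compl, ?_, fun ω hω => ?_⟩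
  · rw [prob_compl_eq_one_sub (measurableSet_toMeasurable _ _), measure_toMeasurable,
      ENNReal.ofReal_sub _ h0.le, ENNReal.ofReal_one]
    exact tsub_le_tsub_left hμBad 1
  · have hωB : ω ∉ Bad := fun h => hω (subset_toMeasurable _ _ h)
    rw [hBad, Set.mem_union, not_or] at hωB
    obtain ⟨hωR, hωD⟩ := hωB
    have hn : ∀ n, Fintype.card A ≤ n → n < T → ω ∉ BF n ∧ ω ∉ BG n ∧ ω ∉ BC n := by
      intro n hnK hnT
      have hnS : n ∈ S := by simp [hS, hnK, hnT]
      have h2 : ω ∉ BF n ∪ BG n ∪ BC n := fun h => hωR (Set.mem_biUnion hnS h)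
      simpa only [Set.mem_union, not_or, and_assoc] using h2
    refine ⟨fun n hnK hnT => ?_, fun n hnK hnT => ?_, ?_⟩
    · exact ⟨hV.gstar_mem, not_lt.1 (hn n hnK hnT).2.1, hV.safe_constraint⟩
    · obtain ⟨hF, -, hCn⟩ := hn n hnK hnT
      have hfh := hV.fhat_mem (hist W n ω)
      -- Uniformity over `F` permits the data-dependent choice `f = f̂ᵗ`.
      have h2 : ω ∉ _ := fun h => hCn (Set.mem_biUnion hfh h)
      rw [Set.mem_ofPred_eq, not_lt, one_mul, one_div_div, Finset.sum_range, Finset.sum_range] at h2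
      refine h2.trans ?_
      gcongr
      simp only [BF, Set.mem_ofPred_eq, not_lt] at hF
      refine le_trans ?_ (mul_le_mul_of_nonneg_left hF (sq_nonneg L))
      rw [Finset.mul_sum]
      refine Finset.sum_le_sum fun i _ => ?_
      rw [← mul_pow, ← sq_abs]
      exact pow_le_pow_left₀ (abs_nonneg _) (hV.lip₁ _ (mem_members hfh _) _
        (mem_members hV.fstar_mem _)) 2
    · simp only [BD, Set.mem_ofPred_eq, not_lt] at hωD
      rw [Finset.sum_filter, Finset.sum_filter]
      refine le_trans (le_of_eq (Finset.sum_congr rfl fun n _ => ?_)) hωD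
      by_cases hnK : Fintype.card A ≤ n <;> simp [φ, hnK]

end GoodEvent

end GEDUCB

/-! ### The main theorem -/

theorem mainTheorem1 (L CD : ℝ) :
    ∃ c : ℝ, 0 < c ∧
      ∀ {X A Y Z Ω : Type*} [MeasurableSpace X] [Fintype A] [MeasurableSpace A]
        [DiscreteMeasurableSpace A] [MeasurableSpace Y] [MeasurableSpace Z] [MeasurableSpace Ω]
        (P : GEDUCB.Problem X A Y Z), P.Valid L CD →
      ∀ (δ : ℝ), 0 < δ → δ < 1 →
      ∀ (T : ℕ), 1 ≤ T →
        MonotoneOn (P.radF δ) (Set.Icc 1 T) → MonotoneOn (P.radG δ) (Set.Icc 1 T) →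
      ∀ (pol : (n : ℕ) → ProbabilityTheory.Kernel (GEDUCB.Hist X A Y Z n × X) A)
        [∀ n, ProbabilityTheory.IsMarkovKernel (pol n)], P.IsGEDUCB L δ pol →
      ∀ (μ : MeasureTheory.Measure Ω) [MeasureTheory.IsProbabilityMeasure μ]
        (W : ℕ → Ω → X × A × Y × Z), P.IsInteraction pol μ W →
      ∃ E : Set Ω, MeasurableSet E ∧ ENNReal.ofReal (1 - δ) ≤ μ E ∧
        ∀ ω ∈ E,
          -- feasibility, at every context, in every round `t = n + 1` with `K < t ≤ T`
          (∀ n, Fintype.card A ≤ n → n < T → ∀ x : X,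
            GEDUCB.avg P.T₂ P.gstar x (pol n (GEDUCB.hist W n ω, x)) ≤ P.τ) ∧
          -- regret against every feasible policy, in particular the optimal one
          (∀ (πs : ProbabilityTheory.Kernel X A) [ProbabilityTheory.IsMarkovKernel πs],
            P.IsFeasiblePolicy πs → P.regret pol W T πs ω ≤ c * P.rate L δ T) := by
  refine ⟨2 + |L| * (4 + 2 * |CD|), by positivity, ?_⟩
  intro X A Y Z Ω _ _ _ _ _ _ _ P hV δ h0 h1 T hT hmonoF hmonoG pol _ hpol μ _ W hI
  have hG : P.G.Nonempty := ⟨_, hV.gstar_mem⟩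
  have hradF := hI.radF_nonneg hV h0 h1
  have hradG := hI.radG_nonneg hV h0 h1 (T - 1)
  rw [Nat.sub_add_cancel hT] at hradG
  obtain ⟨E, hE, hμE, hgood⟩ := hI.exists_good_event hV hG h0 h1 T
  refine ⟨E, hE, hμE, fun ω hω => ?_⟩
  obtain ⟨hconf, hres, hdiam⟩ := hgood ω hω
  refine ⟨fun n hnK hnT x => hV.feasible_of_mem_feasSet (hconf n hnK hnT)
    (hpol.mem n hnK _ x), fun πs _ hπs => ?_⟩
  -- If `T ≤ K` every round is warm-up, and the regret is at most `T`, hence at most the rate.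
  rcases lt_or_ge (Fintype.card A) T with hKT | hTK
  · exact hpol.regret_le hV hG h0 h1 hT hKT hradF hradG hmonoF hmonoG ω hconf hres hdiam πs hπs
  · have hradFT := hradF (T - 1)
    rw [Nat.sub_add_cancel hT] at hradFT
    have hreg := hV.regret_le_natCast (pol := pol) (W := W) T πs ω
    have hrate := hV.natCast_le_rate (W 0 ω).1 h0 h1 hT hTK hradFT
    have hc : 0 ≤ |L| * (4 + 2 * |CD|) := by positivity
    have hT0 : (0 : ℝ) ≤ T := Nat.cast_nonneg T
    nlinarith [mul_nonneg hc (hT0.trans hrate)]
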